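/- For integers $n \ge 0$ and $r \ge 2$, let $\mathcal{M}(n,r)$ be the (finite, non-empty) set of $n \times n$ matrices $A=(a_{ij})$ with non-negative integer entries all of whose row sums and column sums equal $r$ (magical squares of dimension $n$ and line sum $r$). A component of $A \in \mathcal{M}(n,r)$ is a pair $(S,T)$ of non-empty subsets of $\{1,\dots,n\}$ of equal cardinality $k$ such that every row sum and every column sum of the submatrix $(a_{ij})_{i\in S,\,j\in T}$ equals $r$; it is then called a $k$-component. A component $(S,T)$ is irreducible if the only component $(S',T')$ with $S'\subseteq S$ and $T'\subseteq T$ is $(S,T)$ itself. For $k\ge 1$ let $\chi_k(A)$ be the number of irreducible $k$-components of $A$; equivalently, $\chi_k(A)$ is the number of connected components with $2k$ vertices of the $r$-regular bipartite multigraph with biadjacency matrix $A$. **Theorem.** Fix an integer $r \ge 2$ and, for each $n$, let $\mathcal{A}_n$ be a random matrix uniformly distributed on $\mathcal{M}(n,r)$. Then, as $n \to \infty$, $$\bigl(\chi_1(\mathcal{A}_n), \chi_2(\mathcal{A}_n), \ldots\bigr) \stackrel{d}{\longrightarrow} (Z_1, Z_2, \ldots),$$ in the sense of weak convergence of laws on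 the sequence space $\{0,1,2,\ldots\}^{\{1,2,\ldots\}}$ with the product topology (that is, convergence in distribution of $(\chi_1(\mathcal{A}_n),\dots,\chi_k(\mathcal{A}_n))$ to $(Z_1,\dots,Z_k)$ for every fixed $k$), where 1. if $r = 2$, the $Z_i$, $i \ge 1$, are independent, $Z_1 \sim \mathrm{Poisson}(1)$, and $Z_i \sim \mathrm{Poisson}(1/(2i))$ for all $i \ge 2$; 2. if $r \ge 3$, $Z_i = 0$ for all $i \ge 1$. -/

import Mathlib

open MeasureTheory ProbabilityTheory Filter
open scoped NNReal

namespace MagicalSquare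

/-- The discrete σ-algebra on the countable set of `n × n` matrices with non-negative integer
entries (the same as the product σ-algebra). -/
instance instMeasurableSpaceNatMatrix (n : ℕ) : MeasurableSpace (Matrix (Fin n) (Fin n) ℕ) := ⊤

instance instDiscreteMeasurableSpaceNatMatrix (n : ℕ) :
    DiscreteMeasurableSpace (Matrix (Fin n) (Fin n) ℕ) :=
  ⟨fun _ ↦ MeasurableSpace.measurableSet_top⟩

/-- The set `M(n, r)` of magical squares of dimension `n` and line sum `r`: the `n × n` matrices
with non-negative integer entries all of whose row sums and column sums are equal to `r`. -/
def magicalSquares (n r : ℕ) : Set (Matrix (Fin n) (Fin n) ℕ) :=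
  {A | (∀ i, ∑ j, A i j = r) ∧ (∀ j, ∑ i, A i j = r)}

/-- `(S, T)` is a `k`-component of the matrix `A` (with respect to the line sum `r`): `S` and `T`
are non-empty sets of `k` row indices and of `k` column indices, and the `k × k` submatrix
`A(S, T)` has all its row sums and column sums equal to `r`. -/
structure IsKComponent {n : ℕ} (r : ℕ) (A : Matrix (Fin n) (Fin n) ℕ) (k : ℕ)
    (S T : Finset (Fin n)) : Prop where
  nonempty_rows : S.Nonempty
  nonempty_cols : T.Nonempty
  card_rows : S.card = k
  card_cols : T.card = k
  row_sum : ∀ i ∈ S, ∑ j ∈ T, A i j = r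
  col_sum : ∀ j ∈ T, ∑ i ∈ S, A i j = r

/-- `(S, T)` is a component of `A` if it is a `k`-component of `A` for some `k`. -/
def IsComponent {n : ℕ} (r : ℕ) (A : Matrix (Fin n) (Fin n) ℕ) (S T : Finset (Fin n)) : Prop :=
  ∃ k, IsKComponent r A k S T

/-- `(S, T)` is an irreducible `k`-component of `A`: a `k`-component that contains no other
component. -/
def IsIrreducibleKComponent {n : ℕ} (r : ℕ) (A : Matrix (Fin n) (Fin n) ℕ) (k : ℕ)
    (S T : Finset (Fin n)) : Prop :=
  IsKComponent r A k S T ∧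
    ∀ S' T' : Finset (Fin n), S' ⊆ S → T' ⊆ T → IsComponent r A S' T' → S' = S ∧ T' = T

/-- The component count `χ_k(A)`: the number of irreducible `k`-components of `A`. For a magical
square `A` with line sum `r ≥ 1` this is the number of connected components with `2k` vertices of
the `r`-regular bipartite multigraph whose biadjacency matrix is `A`. -/
noncomputable def componentCount {n : ℕ} (r : ℕ) (A : Matrix (Fin n) (Fin n) ℕ) (k : ℕ) : ℕ :=
  {p : Finset (Fin n) × Finset (Fin n) | IsIrreducibleKComponent r A k p.1 p.2}.ncard

end MagicalSquare

/-! Write `w n` for `normCard r n`, the number of magical squares divided by `(n!)²`. Choosing an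
irreducible `k`-component of a square of dimension `k + m` means choosing its rows and columns, an
irreducible square on them, and an arbitrary square on the complement. The factor `(n!)²` absorbs
the binomials, so the sum of `x k * F x` at `k + m` becomes `irrRate r k` times the sum of `F (x +
Pi.single k 1)` at `m` (`normSum_apply_mul`). All the asymptotics thus depend on the ratios `w n / w
(n + 1)`.

If the ratio tends to 1, the binomial moments of the `k`-th count converge to `irrRate r k ^ s /
s!`, even when weighted by a bounded statistic that ignores coordinate `k`. Inclusion-exclusion and
dominated convergence then give an independent Poisson factor (`tendsto_normSum_ite_eq`). For `r =
2`, a square is a sum of two permutation matrices `σ`, `τ`, irreducible for `k ≥ 2` exactly when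
`σ⁻¹ * τ` is a `k`-cycle. This gives `irrRate 2 k = 1 / (2 * k)` and a linear recurrence for `w`
that forces the ratio to 1 (`tendsto_normCard_two`).

If `r ≥ 3`, rerouting three entries of a square through a new row and column produces many squares
of dimension `n + 1`, so the ratio is `O(1 / n)` (`tendsto_normCard_div_zero`). The mean of each
component count then tends to 0, and all counts vanish in the limit. In both cases one coordinate at
a time is handled, and convergence on cylinders yields weak convergence. -/

namespace MagicalSquare

/-! ### Blocks of a magic matrix: irreducible blocks partition the rows. -/

section Blocks

variable {ι κ α γ : Type*}

/-- All row sums and all column sums of `A` equal `r`. -/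
def IsMagic [Fintype ι] [Fintype κ] (r : ℕ) (A : Matrix ι κ ℕ) : Prop :=
  (∀ i, ∑ j, A i j = r) ∧ ∀ j, ∑ i, A i j = r

/-- The submatrix of `A` on the non-empty set of rows `S` and the set of columns `T` has all line
sums equal to `r`. -/
structure IsBlock (r : ℕ) (A : Matrix ι κ ℕ) (S : Finset ι) (T : Finset κ) : Prop where
  nonempty : S.Nonempty
  row_sum : ∀ i ∈ S, ∑ j ∈ T, A i j = r
  col_sum : ∀ j ∈ T, ∑ i ∈ S, A i j = r

/-- A block that contains no other block. -/
def IsIrrBlock (r : ℕ) (A : Matrix ι κ ℕ) (S : Finset ι) (T : Finset κ) : Prop :=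
  IsBlock r A S T ∧ ∀ S' T', S' ⊆ S → T' ⊆ T → IsBlock r A S' T' → S' = S ∧ T' = T

open Classical in
/-- The finite set of irreducible blocks of `A`. -/
noncomputable def irrBlocks [Fintype ι] [Fintype κ] (r : ℕ) (A : Matrix ι κ ℕ) :
    Finset (Finset ι × Finset κ) :=
  Finset.univ.filter fun p ↦ IsIrrBlock r A p.1 p.2

/-- The number of irreducible blocks of `A` with `k` rows. -/
noncomputable def blockCount [Fintype ι] [Fintype κ] (r : ℕ) (A : Matrix ι κ ℕ) (k : ℕ) : ℕ :=
  ((irrBlocks r A).filter fun p ↦ p.1.card = k).card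

@[simp]
lemma mem_irrBlocks [Fintype ι] [Fintype κ] {r : ℕ} {A : Matrix ι κ ℕ}
    {p : Finset ι × Finset κ} : p ∈ irrBlocks r A ↔ IsIrrBlock r A p.1 p.2 := by
  simp [irrBlocks]

/-- Double counting of the total of the submatrix. This is why `IsBlock` need not require equal
cardinalities. -/
lemma IsBlock.card_eq {r : ℕ} (hr : 0 < r) {A : Matrix ι κ ℕ} {S : Finset ι} {T : Finset κ}
    (h : IsBlock r A S T) : S.card = T.card := by
  have h1 : ∑ i ∈ S, ∑ j ∈ T, A i j = S.card * r := by
    rw [Finset.sum_congr rfl h.row_sum, Finset.sum_const, smul_eq_mul]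
  have h2 : ∑ i ∈ S, ∑ j ∈ T, A i j = T.card * r := by
    refine Finset.sum_comm.trans ?_
    rw [Finset.sum_congr rfl h.col_sum, Finset.sum_const, smul_eq_mul]
  exact Nat.eq_of_mul_eq_mul_right hr (h1.symm.trans h2)

lemma IsBlock.nonempty_cols {r : ℕ} (hr : 0 < r) {A : Matrix ι κ ℕ} {S : Finset ι} {T : Finset κ}
    (h : IsBlock r A S T) : T.Nonempty := by
  rw [← Finset.card_pos, ← h.card_eq hr, Finset.card_pos]
  exact h.nonempty

lemma isBlock_map {r : ℕ} {A : Matrix ι κ ℕ} (e : α ↪ ι) (f : γ ↪ κ) {S : Finset α}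
    {T : Finset γ} : IsBlock r A (S.map e) (T.map f) ↔ IsBlock r (A.submatrix e f) S T := by
  constructor
  · rintro ⟨h1, h2, h3⟩
    exact ⟨by simpa using h1, by simpa using h2, by simpa using h3⟩
  · rintro ⟨h1, h2, h3⟩
    exact ⟨by simpa using h1, by simpa using h2, by simpa using h3⟩

lemma isIrrBlock_map {r : ℕ} {A : Matrix ι κ ℕ} (e : α ↪ ι) (f : γ ↪ κ) {S : Finset α}
    {T : Finset γ} : IsIrrBlock r A (S.map e) (T.map f) ↔ IsIrrBlock r (A.submatrix e f) S T := by
  simp only [IsIrrBlock, isBlock_map]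
  refine and_congr_right fun _ ↦ ⟨fun h S' T' hS hT hb ↦ ?_, fun h S' T' hS hT hb ↦ ?_⟩
  · simpa using h (S'.map e) (T'.map f) (Finset.map_subset_map.2 hS) (Finset.map_subset_map.2 hT)
      ((isBlock_map e f).2 hb)
  · obtain ⟨S', hS', rfl⟩ := Finset.subset_map_iff.1 hS
    obtain ⟨T', hT', rfl⟩ := Finset.subset_map_iff.1 hT
    simpa using h S' T' hS' hT' ((isBlock_map e f).1 hb)

lemma blockCount_submatrix [Fintype ι] [Fintype κ] [Fintype α] [Fintype γ] (r : ℕ)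
    (A : Matrix ι κ ℕ) (e : α ≃ ι) (f : γ ≃ κ) :
    blockCount r (A.submatrix e f) = blockCount r A := by
  funext k
  refine Finset.card_bij' (fun p _ ↦ (p.1.map e.toEmbedding, p.2.map f.toEmbedding))
    (fun p _ ↦ (p.1.map e.symm.toEmbedding, p.2.map f.symm.toEmbedding)) ?_ ?_ ?_ ?_
  · intro p hp
    simp only [Finset.mem_filter, mem_irrBlocks, Finset.card_map] at hp ⊢
    exact ⟨(isIrrBlock_map e.toEmbedding f.toEmbedding).2 hp.1, hp.2⟩
  · intro p hp
    simp only [Finset.mem_filter, mem_irrBlocks, Finset.card_map] at hp ⊢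
    refine ⟨(isIrrBlock_map e.symm.toEmbedding f.symm.toEmbedding).2 ?_, hp.2⟩
    simpa [Matrix.submatrix_submatrix] using hp.1
  · intro p hp
    ext <;> simp
  · intro p hp
    ext <;> simp

lemma IsMagic.submatrix [Fintype ι] [Fintype κ] [Fintype α] [Fintype γ] {r : ℕ}
    {A : Matrix ι κ ℕ} (h : IsMagic r A) (e : α ≃ ι) (f : γ ≃ κ) :
    IsMagic r (A.submatrix e f) :=
  ⟨fun i ↦ by simpa using (f.sum_comp (A (e i))).trans (h.1 (e i)),
    fun j ↦ by simpa using (e.sum_comp (fun i ↦ A i (f j))).trans (h.2 (f j))⟩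

section Magic

variable [Fintype ι] [Fintype κ] {r : ℕ} {A : Matrix ι κ ℕ}
  {S S' : Finset ι} {T T' : Finset κ}

lemma IsMagic.le (hA : IsMagic r A) (i : ι) (j : κ) : A i j ≤ r :=
  (Finset.single_le_sum (f := A i) (fun _ _ ↦ Nat.zero_le _) (Finset.mem_univ j)).trans (hA.1 i).le

lemma IsMagic.isBlock_univ [Nonempty ι] (hA : IsMagic r A) :
    IsBlock r A Finset.univ Finset.univ :=
  ⟨Finset.univ_nonempty, fun i _ ↦ hA.1 i, fun j _ ↦ hA.2 j⟩

/-- The row already attains its full sum `r` inside `T`. With the column version this says that no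
edge leaves a block, whence blocks are stable under intersection and difference. -/
lemma IsBlock.eq_zero_right (hA : IsMagic r A) (h : IsBlock r A S T) {i : ι} {j : κ} (hi : i ∈ S)
    (hj : j ∉ T) : A i j = 0 := by
  classical
  have h1 := h.row_sum i hi
  have h2 := hA.1 i
  rw [← Finset.sum_add_sum_compl T] at h2
  have h3 : ∑ j ∈ Tᶜ, A i j = 0 := by omega
  exact Finset.sum_eq_zero_iff.1 h3 j (by simpa using hj)

lemma IsBlock.eq_zero_left (hA : IsMagic r A) (h : IsBlock r A S T) {i : ι} {j : κ} (hi : i ∉ S)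
    (hj : j ∈ T) : A i j = 0 := by
  classical
  have h1 := h.col_sum j hj
  have h2 := hA.2 j
  rw [← Finset.sum_add_sum_compl S] at h2
  have h3 : ∑ i ∈ Sᶜ, A i j = 0 := by omega
  exact Finset.sum_eq_zero_iff.1 h3 i (by simpa using hi)

lemma IsBlock.inter [DecidableEq ι] [DecidableEq κ] (hA : IsMagic r A) (h : IsBlock r A S T)
    (h' : IsBlock r A S' T') (hne : (S ∩ S').Nonempty) : IsBlock r A (S ∩ S') (T ∩ T') := by
  refine ⟨hne, fun i hi ↦ ?_, fun j hj ↦ ?_⟩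
  · rw [Finset.mem_inter] at hi
    rw [← h.row_sum i hi.1]
    refine Finset.sum_subset Finset.inter_subset_left fun j hj hj' ↦ ?_
    exact h'.eq_zero_right hA hi.2 (fun hj2 ↦ hj' (Finset.mem_inter.2 ⟨hj, hj2⟩))
  · rw [Finset.mem_inter] at hj
    rw [← h.col_sum j hj.1]
    refine Finset.sum_subset Finset.inter_subset_left fun i hi hi' ↦ ?_
    exact h'.eq_zero_left hA (fun hi2 ↦ hi' (Finset.mem_inter.2 ⟨hi, hi2⟩)) hj.2

lemma IsBlock.sdiff [DecidableEq ι] [DecidableEq κ] (hA : IsMagic r A) (h : IsBlock r A S T)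
    (h' : IsBlock r A S' T') (hne : (S \ S').Nonempty) :
    IsBlock r A (S \ S') (T \ T') := by
  refine ⟨hne, fun i hi ↦ ?_, fun j hj ↦ ?_⟩
  · rw [Finset.mem_sdiff] at hi
    rw [← h.row_sum i hi.1]
    refine Finset.sum_subset Finset.sdiff_subset fun j hj hj' ↦ ?_
    exact h'.eq_zero_left hA hi.2 (by simpa [hj] using hj')
  · rw [Finset.mem_sdiff] at hj
    rw [← h.col_sum j hj.1]
    refine Finset.sum_subset Finset.sdiff_subset fun i hi hi' ↦ ?_
    exact h'.eq_zero_right hA (by simpa [hi] using hi') hj.2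

lemma IsBlock.exists_mem_row (hr : 0 < r) (hA : IsMagic r A) (h : IsBlock r A S T)
    (h' : IsBlock r A S' T') {j : κ} (hj : j ∈ T) (hj' : j ∈ T') : ∃ i ∈ S, i ∈ S' := by
  by_contra! hcon
  have := h.col_sum j hj
  rw [Finset.sum_eq_zero fun i hi ↦ h'.eq_zero_left hA (hcon i hi) hj'] at this
  omega

lemma IsIrrBlock.eq_of_mem (hA : IsMagic r A) (h : IsIrrBlock r A S T)
    (h' : IsIrrBlock r A S' T') {i : ι} (hi : i ∈ S) (hi' : i ∈ S') : S = S' ∧ T = T' := by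
  classical
  have hb := h.1.inter hA h'.1 ⟨i, Finset.mem_inter.2 ⟨hi, hi'⟩⟩
  have h1 := h.2 _ _ Finset.inter_subset_left Finset.inter_subset_left hb
  have h2 := h'.2 _ _ Finset.inter_subset_right Finset.inter_subset_right hb
  exact ⟨h1.1.symm.trans h2.1, h1.2.symm.trans h2.2⟩

/-- Take a block through `i` with the fewest rows. A sub-block avoiding `i` could be removed from
it, leaving a smaller block through `i`. -/
lemma IsMagic.exists_isIrrBlock (hr : 0 < r) (hA : IsMagic r A) (i : ι) :
    ∃ S T, IsIrrBlock r A S T ∧ i ∈ S := by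
  classical
  have : Nonempty ι := ⟨i⟩
  obtain ⟨p, hp, hmin⟩ := Finset.exists_min_image
    (Finset.univ.filter fun p : Finset ι × Finset κ ↦ IsBlock r A p.1 p.2 ∧ i ∈ p.1)
    (fun p ↦ p.1.card) ⟨(Finset.univ, Finset.univ), by simp [hA.isBlock_univ]⟩
  simp only [Finset.mem_filter, Finset.mem_univ, true_and, Prod.forall] at hp hmin
  refine ⟨p.1, p.2, ⟨hp.1, fun S' T' hS hT hb ↦ ?_⟩, hp.2⟩
  have hi : i ∈ S' := by
    by_contra hi
    have h1 := hmin _ _ ⟨hp.1.sdiff hA hb ⟨i, Finset.mem_sdiff.2 ⟨hp.2, hi⟩⟩,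
      Finset.mem_sdiff.2 ⟨hp.2, hi⟩⟩
    obtain ⟨a, ha⟩ := hb.nonempty
    have := Finset.card_lt_card (Finset.ssubset_iff_subset_ne.2
      ⟨Finset.sdiff_subset (s := p.1) (t := S'), fun h ↦ by
        have h2 := hS ha
        rw [← h, Finset.mem_sdiff] at h2
        exact h2.2 ha⟩)
    omega
  have hc := hmin S' T' ⟨hb, hi⟩
  refine ⟨Finset.eq_of_subset_of_card_le hS hc, Finset.eq_of_subset_of_card_le hT ?_⟩
  rw [← hp.1.card_eq hr, ← hb.card_eq hr]
  exact hc

lemma IsMagic.sum_card_irrBlocks (hr : 0 < r) (hA : IsMagic r A) :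
    ∑ p ∈ irrBlocks r A, p.1.card = Fintype.card ι := by
  classical
  have h1 : (irrBlocks r A).biUnion Prod.fst = Finset.univ := by
    ext i
    obtain ⟨S, T, h, hi⟩ := hA.exists_isIrrBlock hr i
    simp only [Finset.mem_biUnion, mem_irrBlocks, Prod.exists, Finset.mem_univ, iff_true]
    exact ⟨S, T, h, hi⟩
  rw [← Finset.card_univ, ← h1, Finset.card_biUnion]
  intro p hp q hq hpq
  refine Finset.disjoint_left.2 fun i hi hi' ↦ ?_
  have := (mem_irrBlocks.1 hp).eq_of_mem hA (mem_irrBlocks.1 hq) hi hi'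
  exact hpq (Prod.ext this.1 this.2)

lemma IsMagic.sum_mul_blockCount (hr : 0 < r) (hA : IsMagic r A) :
    ∑ k ∈ Finset.range (Fintype.card ι + 1), k * blockCount r A k = Fintype.card ι := by
  refine Eq.trans ?_ (hA.sum_card_irrBlocks hr)
  rw [← Finset.sum_fiberwise_of_maps_to (s := irrBlocks r A)
    (t := Finset.range (Fintype.card ι + 1)) (g := fun p ↦ p.1.card)
    (fun p _ ↦ by simpa [Nat.lt_succ_iff] using Finset.card_le_univ p.1)]
  refine Finset.sum_congr rfl fun k _ ↦ ?_
  rw [Finset.sum_congr rfl fun p hp ↦ (Finset.mem_filter.1 hp).2, Finset.sum_const, blockCount,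
    smul_eq_mul, mul_comm]

variable (r ι κ) in
lemma finite_isMagic : {A : Matrix ι κ ℕ | IsMagic r A}.Finite := by
  have h : {A : ι → κ → ℕ | ∀ i, A i ∈ {v : κ → ℕ | ∀ j, v j ∈ Set.Iic r}}.Finite :=
    Set.Finite.pi' fun _ ↦ Set.Finite.pi' fun _ ↦ Set.finite_Iic r
  exact h.subset fun A hA i j ↦ IsMagic.le hA i j

variable (r ι κ) in
/-- The finite set of matrices with line sums `r`. -/
noncomputable def magics : Finset (Matrix ι κ ℕ) := (finite_isMagic ι κ r).toFinset

@[simp]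
lemma mem_magics : A ∈ magics ι κ r ↔ IsMagic r A := by simp [magics]

end Magic

end Blocks

/-! ### Block-diagonal decomposition along an irreducible block. -/

section Splitting

lemma isIrrBlock_fromBlocks_inl {α β γ δ : Type*} [Fintype α] [Fintype γ] {r : ℕ}
    {B : Matrix α γ ℕ} {C : Matrix β δ ℕ} :
    IsIrrBlock r (Matrix.fromBlocks B 0 0 C) (Finset.univ.map Function.Embedding.inl)
      (Finset.univ.map Function.Embedding.inl) ↔ IsIrrBlock r B Finset.univ Finset.univ := by
  rw [isIrrBlock_map]
  rfl

variable {α β γ δ : Type*} [Fintype α] [Fintype β] [Fintype γ] [Fintype δ] {r : ℕ}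

lemma isMagic_fromBlocks {B : Matrix α γ ℕ} {C : Matrix β δ ℕ} :
    IsMagic r (Matrix.fromBlocks B 0 0 C) ↔ IsMagic r B ∧ IsMagic r C := by
  simp only [IsMagic, Sum.forall, Fintype.sum_sum_type, Matrix.fromBlocks_apply₁₁,
    Matrix.fromBlocks_apply₁₂, Matrix.fromBlocks_apply₂₁, Matrix.fromBlocks_apply₂₂,
    Matrix.zero_apply, Finset.sum_const_zero, add_zero, zero_add]
  tauto

lemma IsBlock.eq_fromBlocks {A : Matrix (α ⊕ β) (γ ⊕ δ) ℕ} (hA : IsMagic r A)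
    (h : IsBlock r A (Finset.univ.map Function.Embedding.inl)
      (Finset.univ.map Function.Embedding.inl)) :
    Matrix.fromBlocks A.toBlocks₁₁ 0 0 A.toBlocks₂₂ = A := by
  ext (i | i) (j | j)
  · rfl
  · exact (h.eq_zero_right hA (by simp) (by simp)).symm
  · exact (h.eq_zero_left hA (by simp) (by simp)).symm
  · rfl

/-- Entries off the two diagonal blocks vanish, so such a matrix is the same as an irreducible
square `B` together with an arbitrary square `C`. -/
lemma sum_isIrrBlock_inl {M : Type*} [AddCommMonoid M]
    [DecidablePred fun A : Matrix (α ⊕ β) (γ ⊕ δ) ℕ ↦ IsIrrBlock r A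
      (Finset.univ.map Function.Embedding.inl) (Finset.univ.map Function.Embedding.inl)]
    [DecidablePred fun B : Matrix α γ ℕ ↦ IsIrrBlock r B Finset.univ Finset.univ]
    (G : Matrix (α ⊕ β) (γ ⊕ δ) ℕ → M) :
    ∑ A ∈ (magics (α ⊕ β) (γ ⊕ δ) r).filter (fun A ↦ IsIrrBlock r A
        (Finset.univ.map Function.Embedding.inl) (Finset.univ.map Function.Embedding.inl)), G A =
      ∑ B ∈ (magics α γ r).filter (fun B ↦ IsIrrBlock r B Finset.univ Finset.univ),
        ∑ C ∈ magics β δ r, G (Matrix.fromBlocks B 0 0 C) := by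
  rw [← Finset.sum_product']
  refine Finset.sum_bij' (fun A _ ↦ (A.toBlocks₁₁, A.toBlocks₂₂))
    (fun p _ ↦ Matrix.fromBlocks p.1 0 0 p.2) ?_ ?_ ?_ ?_ ?_
  · intro A hA
    simp only [Finset.mem_filter, mem_magics, Finset.mem_product] at hA ⊢
    have h := IsBlock.eq_fromBlocks hA.1 hA.2.1
    rw [← h, isMagic_fromBlocks, isIrrBlock_fromBlocks_inl] at hA
    exact ⟨⟨hA.1.1, hA.2⟩, hA.1.2⟩
  · intro p hp
    simp only [Finset.mem_filter, mem_magics, Finset.mem_product] at hp ⊢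
    rw [isMagic_fromBlocks, isIrrBlock_fromBlocks_inl]
    exact ⟨⟨hp.1.1, hp.2⟩, hp.1.2⟩
  · intro A hA
    simp only [Finset.mem_filter, mem_magics] at hA
    exact IsBlock.eq_fromBlocks hA.1 hA.2.1
  · intro p hp
    simp
  · intro A hA
    simp only [Finset.mem_filter, mem_magics] at hA
    rw [IsBlock.eq_fromBlocks hA.1 hA.2.1]

/-- An irreducible block meeting the rows of `B` coincides with `B`; any other one also avoids the
columns of `B`, hence lives inside `C`. -/
lemma irrBlocks_fromBlocks [DecidableEq (Finset (α ⊕ β) × Finset (γ ⊕ δ))] (hr : 0 < r)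
    {B : Matrix α γ ℕ} {C : Matrix β δ ℕ} (hB : IsMagic r B)
    (hirr : IsIrrBlock r B Finset.univ Finset.univ) (hC : IsMagic r C) :
    irrBlocks r (Matrix.fromBlocks B 0 0 C) =
      insert (Finset.univ.map Function.Embedding.inl, Finset.univ.map Function.Embedding.inl)
        ((irrBlocks r C).map ((Finset.mapEmbedding Function.Embedding.inr).toEmbedding.prodMap
          (Finset.mapEmbedding Function.Embedding.inr).toEmbedding)) := by
  have hA := isMagic_fromBlocks.2 ⟨hB, hC⟩
  have hI := isIrrBlock_fromBlocks_inl (C := C).2 hirr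
  ext ⟨S, T⟩
  simp only [mem_irrBlocks, Finset.mem_insert, Finset.mem_map, Prod.exists,
    Function.Embedding.coe_prodMap, Prod.map_apply, RelEmbedding.coe_toEmbedding,
    Finset.mapEmbedding_apply, Prod.mk.injEq]
  constructor
  · intro h
    by_cases hS : ∃ a, Sum.inl a ∈ S
    · obtain ⟨a, ha⟩ := hS
      exact Or.inl (h.eq_of_mem hA hI ha (by simp))
    · right
      push Not at hS
      have hT : ∀ c, Sum.inl c ∉ T := fun c hc ↦ by
        obtain ⟨i, hi, hi'⟩ := IsBlock.exists_mem_row hr hA h.1 hI.1 hc (by simp)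
        simp only [Finset.mem_map, Finset.mem_univ, true_and] at hi'
        obtain ⟨a, rfl⟩ := hi'
        exact hS a hi
      have hS' : S ⊆ Finset.univ.map Function.Embedding.inr := by
        rintro (a | b) h
        · exact absurd h (hS a)
        · simp
      have hT' : T ⊆ Finset.univ.map Function.Embedding.inr := by
        rintro (a | b) h
        · exact absurd h (hT a)
        · simp
      obtain ⟨S', -, rfl⟩ := Finset.subset_map_iff.1 hS'
      obtain ⟨T', -, rfl⟩ := Finset.subset_map_iff.1 hT'
      exact ⟨S', T', (isIrrBlock_map _ _).1 h, rfl, rfl⟩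
  · rintro (⟨rfl, rfl⟩ | ⟨S', T', h, rfl, rfl⟩)
    · exact hI
    · exact (isIrrBlock_map _ _).2 h

lemma blockCount_fromBlocks (hr : 0 < r) {B : Matrix α γ ℕ} {C : Matrix β δ ℕ}
    (hB : IsMagic r B) (hirr : IsIrrBlock r B Finset.univ Finset.univ) (hC : IsMagic r C) :
    blockCount r (Matrix.fromBlocks B 0 0 C) =
      blockCount r C + Pi.single (Fintype.card α) 1 := by
  classical
  funext k
  have hne : Nonempty α := Finset.univ_nonempty_iff.1 hirr.1.nonempty
  rw [blockCount, irrBlocks_fromBlocks hr hB hirr hC, Finset.filter_insert, Finset.filter_map]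
  simp only [Finset.card_map, Finset.card_univ, Pi.add_apply, Pi.single_apply]
  split_ifs with h1 h2 h2
  · rw [Finset.card_insert_of_notMem, Finset.card_map]
    · simp [blockCount, Function.comp_def]
    · simp only [Finset.mem_map, Prod.exists, not_exists, not_and]
      rintro S T - h
      have : Sum.inl (Classical.arbitrary α) ∈ (Finset.univ.map Function.Embedding.inl :
        Finset (α ⊕ β)) := by simp
      have h' : S.map Function.Embedding.inr = Finset.univ.map Function.Embedding.inl :=
        congrArg Prod.fst h
      rw [← h'] at this
      simp at this
  · exact absurd h1.symm h2
  · exact absurd h2.symm h1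
  · simp [blockCount, Function.comp_def]

end Splitting

/-! ### Sums over magical squares weighted by a component count. -/

section Sums

open Classical in
/-- The number of `k × k` matrices with line sums `r` that have no proper block. -/
noncomputable def irrCount (r k : ℕ) : ℕ :=
  ((magics (Fin k) (Fin k) r).filter fun B ↦ IsIrrBlock r B Finset.univ Finset.univ).card

/-- The sum of a statistic of the block counts over the magical squares of dimension `n`. -/
noncomputable def countSum (r n : ℕ) (F : (ℕ → ℕ) → ℝ) : ℝ :=
  ∑ A ∈ magics (Fin n) (Fin n) r, F (blockCount r A)

lemma sum_isIrrBlock {r k m : ℕ} (hr : 0 < r) {S T : Finset (Fin (k + m))} (hS : S.card = k)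
    (hT : T.card = k) [DecidablePred fun A : Matrix (Fin (k + m)) (Fin (k + m)) ℕ ↦
      IsIrrBlock r A S T] (F : (ℕ → ℕ) → ℝ) :
    ∑ A ∈ (magics (Fin (k + m)) (Fin (k + m)) r).filter (fun A ↦ IsIrrBlock r A S T),
        F (blockCount r A) =
      irrCount r k * countSum r m (fun x ↦ F (x + Pi.single k 1)) := by
  classical
  have hS' : Sᶜ.card = m := by simp [Finset.card_compl, hS]
  have hT' : Tᶜ.card = m := by simp [Finset.card_compl, hT]
  let e := finSumEquivOfFinset hS hS'
  let f := finSumEquivOfFinset hT hT'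
  have he : (Finset.univ.map Function.Embedding.inl).map e.toEmbedding = S := by
    refine Finset.eq_of_subset_of_card_le (fun i hi ↦ ?_) (by simp [hS])
    simp only [Finset.mem_map, Finset.mem_univ, true_and] at hi
    obtain ⟨_, ⟨a, rfl⟩, rfl⟩ := hi
    simp [e]
  have hf : (Finset.univ.map Function.Embedding.inl).map f.toEmbedding = T := by
    refine Finset.eq_of_subset_of_card_le (fun i hi ↦ ?_) (by simp [hT])
    simp only [Finset.mem_map, Finset.mem_univ, true_and] at hi
    obtain ⟨_, ⟨a, rfl⟩, rfl⟩ := hi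
    simp [f]
  have h1 : ∑ A ∈ (magics (Fin (k + m)) (Fin (k + m)) r).filter (fun A ↦ IsIrrBlock r A S T),
        F (blockCount r A) =
      ∑ A ∈ (magics (Fin k ⊕ Fin m) (Fin k ⊕ Fin m) r).filter (fun A ↦ IsIrrBlock r A
        (Finset.univ.map Function.Embedding.inl) (Finset.univ.map Function.Embedding.inl)),
        F (blockCount r A) := by
    refine Finset.sum_bij' (fun A _ ↦ A.submatrix e f) (fun A _ ↦ A.submatrix e.symm f.symm)
      ?_ ?_ ?_ ?_ ?_
    · intro A hA
      simp only [Finset.mem_filter, mem_magics] at hA ⊢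
      refine ⟨hA.1.submatrix e f, (isIrrBlock_map e.toEmbedding f.toEmbedding).1 ?_⟩
      rw [he, hf]
      exact hA.2
    · intro A hA
      simp only [Finset.mem_filter, mem_magics] at hA ⊢
      refine ⟨hA.1.submatrix e.symm f.symm, ?_⟩
      rw [← he, ← hf]
      refine (isIrrBlock_map e.toEmbedding f.toEmbedding).2 ?_
      simpa [Matrix.submatrix_submatrix] using hA.2
    · intro A _
      simp [Matrix.submatrix_submatrix]
    · intro A _
      simp [Matrix.submatrix_submatrix]
    · intro A _
      rw [blockCount_submatrix]
  rw [h1, sum_isIrrBlock_inl, irrCount, countSum, ← nsmul_eq_mul, ← Finset.sum_const]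
  refine Finset.sum_congr rfl fun B hB ↦ Finset.sum_congr rfl fun C hC ↦ ?_
  simp only [Finset.mem_filter, mem_magics] at hB hC
  rw [blockCount_fromBlocks hr hB.1 hB.2 hC, Fintype.card_fin]

/-- Expand the count `x k` into indicators over pairs of `k`-subsets. By relabelling, each of the
`(k + m).choose k ^ 2` pairs contributes the same amount. -/
lemma countSum_blockCount_mul {r : ℕ} (hr : 0 < r) (k m : ℕ) (F : (ℕ → ℕ) → ℝ) :
    countSum r (k + m) (fun x ↦ x k * F x) =
      ((k + m).choose k : ℝ) ^ 2 * irrCount r k *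
        countSum r m (fun x ↦ F (x + Pi.single k 1)) := by
  classical
  have h1 : ∀ A : Matrix (Fin (k + m)) (Fin (k + m)) ℕ, (blockCount r A k : ℝ) =
      ∑ p ∈ Finset.powersetCard k Finset.univ ×ˢ Finset.powersetCard k Finset.univ,
        if IsIrrBlock r A p.1 p.2 then 1 else 0 := fun A ↦ by
    rw [blockCount, Finset.sum_boole]
    congr 2
    ext p
    simp only [Finset.mem_filter, mem_irrBlocks, Finset.mem_product, Finset.mem_powersetCard_univ]
    constructor
    · rintro ⟨h, hk⟩
      exact ⟨⟨hk, h.1.card_eq hr ▸ hk⟩, h⟩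
    · rintro ⟨⟨hk, -⟩, h⟩
      exact ⟨h, hk⟩
  rw [countSum]
  simp only [h1, Finset.sum_mul]
  rw [Finset.sum_comm]
  have h2 : ∀ p ∈ Finset.powersetCard k (Finset.univ : Finset (Fin (k + m))) ×ˢ
      Finset.powersetCard k (Finset.univ : Finset (Fin (k + m))),
      ∑ A ∈ magics (Fin (k + m)) (Fin (k + m)) r,
        (if IsIrrBlock r A p.1 p.2 then (1 : ℝ) else 0) * F (blockCount r A) =
      irrCount r k * countSum r m (fun x ↦ F (x + Pi.single k 1)) := by
    intro p hp
    rw [Finset.mem_product, Finset.mem_powersetCard_univ, Finset.mem_powersetCard_univ] at hp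
    rw [← sum_isIrrBlock hr hp.1 hp.2 F, Finset.sum_filter]
    simp
  rw [Finset.sum_congr rfl h2, Finset.sum_const, Finset.card_product, Finset.card_powersetCard,
    Finset.card_univ, Fintype.card_fin, nsmul_eq_mul]
  push_cast
  ring

lemma blockCount_eq_zero_of_lt {r n k : ℕ} (h : n < k) (A : Matrix (Fin n) (Fin n) ℕ) :
    blockCount r A k = 0 := by
  rw [blockCount, Finset.card_eq_zero, Finset.filter_eq_empty_iff]
  intro p _ hp
  have := Finset.card_le_univ p.1
  simp only [Fintype.card_fin] at this
  omega

end Sums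

/-! ### Counting irreducible squares: line sum 2, and dimension 1. -/

section TwoRegular

open Equiv

variable {α : Type*} [Fintype α] [DecidableEq α]

/-- The sum of two permutation matrices, with entries in `ℕ`. -/
def permSum (σ τ : Perm α) : Matrix α α ℕ :=
  fun i j ↦ (if σ i = j then 1 else 0) + if τ i = j then 1 else 0

/-- Hall's marriage theorem: the rows in `s` carry mass `s.card * r`, all of it in columns of
capacity `r` each. -/
lemma IsMagic.exists_perm {r : ℕ} (hr : 0 < r) {A : Matrix α α ℕ} (hA : IsMagic r A) :
    ∃ σ : Perm α, ∀ i, A i (σ i) ≠ 0 := by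
  have hall : ∀ s : Finset α,
      s.card ≤ (s.biUnion fun i ↦ Finset.univ.filter fun j ↦ A i j ≠ 0).card := fun s ↦ by
    set N := s.biUnion fun i ↦ Finset.univ.filter fun j ↦ A i j ≠ 0 with hN
    have h1 : ∑ i ∈ s, ∑ j ∈ N, A i j = s.card * r := by
      rw [← smul_eq_mul, ← Finset.sum_const]
      refine Finset.sum_congr rfl fun i hi ↦ ?_
      rw [← hA.1 i]
      refine Finset.sum_subset (Finset.subset_univ _) fun j _ hj ↦ ?_
      by_contra hne
      exact hj (Finset.mem_biUnion.2 ⟨i, hi, by simpa using hne⟩)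
    have h2 : ∑ i ∈ s, ∑ j ∈ N, A i j ≤ N.card * r := by
      refine Finset.sum_comm.trans_le ?_
      rw [← smul_eq_mul, ← Finset.sum_const]
      refine Finset.sum_le_sum fun j _ ↦ ?_
      rw [← hA.2 j]
      exact Finset.sum_le_sum_of_subset (Finset.subset_univ _)
    exact Nat.le_of_mul_le_mul_right (h1 ▸ h2) hr
  obtain ⟨f, hf, hf'⟩ := (Finset.all_card_le_biUnion_card_iff_exists_injective _).1 hall
  exact ⟨Equiv.ofBijective f (Finite.injective_iff_bijective.1 hf), fun i ↦ by
    simpa using hf' i⟩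

/-- Subtracting one permutation supported by `A` leaves line sums 1, that is, another permutation
matrix. -/
lemma IsMagic.exists_permSum {A : Matrix α α ℕ} (hA : IsMagic 2 A) :
    ∃ σ τ : Perm α, permSum σ τ = A := by
  obtain ⟨σ, hσ⟩ := hA.exists_perm two_pos
  have hle : ∀ i j, (if σ i = j then 1 else 0) ≤ A i j := fun i j ↦ by
    split_ifs with h
    · exact h ▸ Nat.one_le_iff_ne_zero.2 (hσ i)
    · exact Nat.zero_le _
  let B : Matrix α α ℕ := fun i j ↦ A i j - if σ i = j then 1 else 0
  have hAB : ∀ i j, A i j = B i j + if σ i = j then 1 else 0 :=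
    fun i j ↦ (Nat.sub_add_cancel (hle i j)).symm
  have hB : IsMagic 1 B := by
    refine ⟨fun i ↦ ?_, fun j ↦ ?_⟩
    · have := hA.1 i
      simp only [hAB, Finset.sum_add_distrib, Finset.sum_ite_eq, Finset.mem_univ, if_true] at this
      omega
    · have := hA.2 j
      have h' : ∀ i, (σ i = j) = (i = σ.symm j) := fun i ↦ propext σ.eq_symm_apply.symm
      simp only [hAB, Finset.sum_add_distrib, h', Finset.sum_ite_eq', Finset.mem_univ,
        if_true] at this
      omega
  obtain ⟨τ, hτ⟩ := hB.exists_perm one_pos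
  refine ⟨σ, τ, ?_⟩
  ext i j
  have hBτ : B i j = if τ i = j then 1 else 0 := by
    have h1 := hB.1 i
    rw [← Finset.add_sum_erase _ _ (Finset.mem_univ (τ i))] at h1
    have h2 := hτ i
    split_ifs with h
    · subst h
      omega
    · have h3 : ∑ x ∈ Finset.univ.erase (τ i), B i x = 0 := by omega
      exact Finset.sum_eq_zero_iff.1 h3 j (by simpa using Ne.symm h)
  rw [hAB, hBτ, add_comm]
  rfl

lemma isMagic_permSum (σ τ : Perm α) : IsMagic 2 (permSum σ τ) := by
  refine ⟨fun i ↦ by simp [permSum, Finset.sum_add_distrib], fun j ↦ ?_⟩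
  have h : ∀ (ρ : Perm α) i, (ρ i = j) = (i = ρ.symm j) :=
    fun ρ i ↦ propext ρ.eq_symm_apply.symm
  simp [permSum, Finset.sum_add_distrib, h]

lemma isBlock_permSum {α : Type*} [DecidableEq α] {σ τ : Perm α}
    {S T : Finset α} :
    IsBlock 2 (permSum σ τ) S T ↔
      S.Nonempty ∧ S.map σ.toEmbedding = T ∧ S.map τ.toEmbedding = T := by
  constructor
  · intro h
    have hmem : ∀ i ∈ S, σ i ∈ T ∧ τ i ∈ T := fun i hi ↦ by
      have := h.row_sum i hi
      simp only [permSum, Finset.sum_add_distrib, Finset.sum_ite_eq] at this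
      split_ifs at this <;> simp_all
    have hc := h.card_eq two_pos
    refine ⟨h.nonempty, Finset.eq_of_subset_of_card_le ?_ (by simp [hc]),
      Finset.eq_of_subset_of_card_le ?_ (by simp [hc])⟩
    · intro j hj
      obtain ⟨i, hi, rfl⟩ := Finset.mem_map.1 hj
      exact (hmem i hi).1
    · intro j hj
      obtain ⟨i, hi, rfl⟩ := Finset.mem_map.1 hj
      exact (hmem i hi).2
  · rintro ⟨hS, hσ, hτ⟩
    refine ⟨hS, fun i hi ↦ ?_, fun j hj ↦ ?_⟩
    · have h1 : σ i ∈ T := hσ ▸ Finset.mem_map_of_mem σ.toEmbedding hi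
      have h2 : τ i ∈ T := hτ ▸ Finset.mem_map_of_mem τ.toEmbedding hi
      simp [permSum, Finset.sum_add_distrib, h1, h2]
    · have h : ∀ (ρ : Perm α) i, (ρ i = j) = (i = ρ.symm j) :=
        fun ρ i ↦ propext ρ.eq_symm_apply.symm
      have h1 : σ.symm j ∈ S := by
        rw [← hσ] at hj
        simpa using hj
      have h2 : τ.symm j ∈ S := by
        rw [← hτ] at hj
        simpa using hj
      simp [permSum, Finset.sum_add_distrib, h, h1, h2]

/-- A block is a pair `(S, σ S)` with `σ S = τ S`, so blocks correspond to the non-empty sets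
invariant under `σ⁻¹ * τ`. -/
lemma isIrrBlock_permSum [Nonempty α] {σ τ : Perm α} :
    IsIrrBlock 2 (permSum σ τ) Finset.univ Finset.univ ↔
      ∀ S : Finset α, S.Nonempty → S.map (σ⁻¹ * τ).toEmbedding = S → S = Finset.univ := by
  have key : ∀ S : Finset α, S.map (σ⁻¹ * τ).toEmbedding = S ↔
      S.map τ.toEmbedding = S.map σ.toEmbedding := fun S ↦ by
    have : S.map τ.toEmbedding =
        (S.map (σ⁻¹ * τ).toEmbedding).map σ.toEmbedding := by
      rw [Finset.map_map]
      congr 1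
      ext i
      simp
    rw [this, Finset.map_inj]
  constructor
  · intro h S hS hm
    exact (h.2 S _ (Finset.subset_univ _) (Finset.subset_univ _)
      (isBlock_permSum.2 ⟨hS, rfl, (key S).1 hm⟩)).1
  · intro h
    refine ⟨(isMagic_permSum σ τ).isBlock_univ, fun S T _ _ hb ↦ ?_⟩
    obtain ⟨hS, rfl, h2⟩ := isBlock_permSum.1 hb
    obtain rfl := h S hS ((key S).2 h2)
    simp

lemma cycleType_eq_card_iff (hα : 2 ≤ Fintype.card α) {π : Perm α} :
    π.cycleType = {Fintype.card α} ↔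
      ∀ S : Finset α, S.Nonempty → S.map π.toEmbedding = S → S = Finset.univ := by
  constructor
  · intro h S hS hm
    have hc : π.IsCycle := by
      rw [← Perm.card_cycleType_eq_one, h, Multiset.card_singleton]
    have hsupp : π.support = Finset.univ := by
      rw [hc.cycleType, Multiset.singleton_inj] at h
      exact Finset.card_eq_iff_eq_univ _ |>.1 h
    obtain ⟨a, ha⟩ := hS
    have hpow : ∀ n : ℕ, (π ^ n) a ∈ S := fun n ↦ by
      induction n with
      | zero => simpa using ha
      | succ n ih =>
        rw [pow_succ', Perm.mul_apply, ← hm]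
        exact Finset.mem_map_of_mem π.toEmbedding ih
    refine Finset.eq_univ_of_forall fun b ↦ ?_
    have hne : ∀ x, π x ≠ x := fun x ↦ Perm.mem_support.1 (hsupp ▸ Finset.mem_univ x)
    obtain ⟨n, hn⟩ := (hc.sameCycle (hne a) (hne b)).exists_nat_pow_eq
    exact hn ▸ hpow n
  · intro h
    have hsame : ∀ a b, π.SameCycle a b := fun a b ↦ by
      have := h (Finset.univ.filter fun b ↦ π.SameCycle a b) ⟨a, by simp [Perm.SameCycle.refl]⟩
        (Finset.eq_of_subset_of_card_le (fun x hx ↦ by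
          obtain ⟨y, hy, rfl⟩ := Finset.mem_map.1 hx
          simpa using hy) (by simp))
      have hb := this ▸ Finset.mem_univ b
      simpa using hb
    have hnt : Nontrivial α := Fintype.one_lt_card_iff_nontrivial.1 hα
    have hne : ∀ x, π x ≠ x := fun x hx ↦ by
      obtain ⟨y, hy⟩ := exists_ne x
      exact hy ((hsame x y).eq_of_left hx).symm
    have hc : π.IsCycle := ⟨Classical.arbitrary α, hne _, fun y _ ↦ hsame _ y⟩
    rw [hc.cycleType]
    congr 1
    rw [← Finset.card_univ]
    congr 1
    exact Finset.eq_univ_of_forall fun x ↦ Perm.mem_support.2 (hne x)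

/-- In every row the two decompositions agree up to a swap. The rows where `σ' = σ` form a set
invariant under `σ⁻¹ * τ`, which by irreducibility is empty or everything. -/
lemma IsIrrBlock.eq_or_eq_swap [Nonempty α] {σ τ σ' τ' : Perm α}
    (h : IsIrrBlock 2 (permSum σ τ) Finset.univ Finset.univ)
    (heq : permSum σ' τ' = permSum σ τ) : σ' = σ ∧ τ' = τ ∨ σ' = τ ∧ τ' = σ := by
  have hval : ∀ i, σ' i = σ i ∧ τ' i = τ i ∨ σ' i = τ i ∧ τ' i = σ i := fun i ↦ by
    have h1 := congrFun (congrFun heq i) (σ' i)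
    have h2 := congrFun (congrFun heq i) (τ' i)
    have h3 := congrFun (congrFun heq i) (σ i)
    simp only [permSum] at h1 h2 h3
    grind
  let S : Finset α := Finset.univ.filter fun i ↦ σ' i = σ i
  have hτσ : S.map τ.toEmbedding = S.map σ.toEmbedding := by
    refine Finset.eq_of_subset_of_card_le (fun j hj ↦ ?_) (by simp)
    obtain ⟨i, hi, rfl⟩ := Finset.mem_map.1 hj
    simp only [S, Finset.mem_filter, Finset.mem_univ, true_and] at hi
    obtain ⟨i', hi'⟩ := σ.surjective (τ i)
    refine Finset.mem_map.2 ⟨i', ?_, hi'⟩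
    simp only [S, Finset.mem_filter, Finset.mem_univ, true_and]
    rcases hval i' with h1 | h1
    · exact h1.1
    · have hτ : τ' i = τ i := by
        rcases hval i with h2 | h2
        · exact h2.2
        · rw [h2.2, ← hi, h2.1]
      have h3 : τ' i' = τ' i := by rw [h1.2, hi', hτ]
      obtain rfl := τ'.injective h3
      exact hi
  by_cases hS : S.Nonempty
  · left
    have h1 := (h.2 S _ (Finset.subset_univ _) (Finset.subset_univ _)
      (isBlock_permSum.2 ⟨hS, rfl, hτσ⟩)).1
    have h2 : ∀ i, σ' i = σ i := fun i ↦ by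
      have : i ∈ S := h1 ▸ Finset.mem_univ i
      simpa [S] using this
    refine ⟨Equiv.ext h2, Equiv.ext fun i ↦ ?_⟩
    rcases hval i with h3 | h3
    · exact h3.2
    · rw [h3.2, ← h2, h3.1]
  · right
    rw [Finset.not_nonempty_iff_eq_empty, Finset.filter_eq_empty_iff] at hS
    refine ⟨Equiv.ext fun i ↦ ?_, Equiv.ext fun i ↦ ?_⟩ <;>
    · have := hS (Finset.mem_univ i)
      rcases hval i with h3 | h3
      · exact absurd h3.1 this
      · simp [h3]

/-- Count pairs `(σ, τ)` with `σ⁻¹ * τ` a `k`-cycle in two ways: by `σ` and the cycle, and by the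
sum matrix, which arises from exactly two ordered pairs. -/
lemma two_mul_irrCount_two {k : ℕ} (hk : 2 ≤ k) :
    2 * irrCount 2 k = k.factorial * (k - 1).factorial := by
  classical
  have : Nonempty (Fin k) := ⟨⟨0, by omega⟩⟩
  let P : Finset (Perm (Fin k) × Perm (Fin k)) :=
    Finset.univ.filter fun p ↦ (p.1⁻¹ * p.2).cycleType = {k}
  have hmem : ∀ p : Perm (Fin k) × Perm (Fin k),
      p ∈ P ↔ IsIrrBlock 2 (permSum p.1 p.2) Finset.univ Finset.univ := fun p ↦ by
    have := cycleType_eq_card_iff (α := Fin k) (by simpa using hk) (π := p.1⁻¹ * p.2)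
    rw [Fintype.card_fin] at this
    rw [isIrrBlock_permSum, ← this]
    simp [P]
  have h1 : P.card = k.factorial * (k - 1).factorial := by
    have hfib := Finset.card_eq_sum_card_fiberwise (s := P)
      (t := (Finset.univ : Finset (Perm (Fin k)))) (f := Prod.fst) (fun _ _ ↦ Finset.mem_univ _)
    have hc := Perm.card_of_cycleType_singleton (α := Fin k) hk (by simp)
    rw [hfib, Finset.sum_congr rfl (g := fun _ ↦ (k - 1).factorial), Finset.sum_const,
      Finset.card_univ, Fintype.card_perm, Fintype.card_fin, smul_eq_mul]
    intro σ _
    simp only [Fintype.card_fin, Nat.choose_self, mul_one] at hc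
    rw [← hc]
    refine Finset.card_bij' (fun p _ ↦ p.1⁻¹ * p.2) (fun π _ ↦ (σ, σ * π)) ?_ ?_ ?_ ?_
    · intro p hp
      simp only [P, Finset.mem_filter, Finset.mem_univ, true_and] at hp ⊢
      exact hp.1
    · intro π hπ
      simp only [P, Finset.mem_filter, Finset.mem_univ, true_and] at hπ ⊢
      simpa using hπ
    · rintro ⟨p, q⟩ hp
      simp only [Finset.mem_filter] at hp
      obtain ⟨-, rfl⟩ := hp
      simp
    · intro π _
      simp
  have h2 : P.card = irrCount 2 k * 2 := by
    rw [irrCount]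
    rw [Finset.card_eq_sum_card_fiberwise (f := fun p ↦ permSum p.1 p.2)
      (t := (magics (Fin k) (Fin k) 2).filter fun B ↦ IsIrrBlock 2 B Finset.univ Finset.univ)
      fun p hp ↦ Finset.mem_filter.2
        ⟨mem_magics.2 (isMagic_permSum _ _), (hmem p).1 hp⟩, ← smul_eq_mul, ← Finset.sum_const]
    refine Finset.sum_congr rfl fun B hB ↦ ?_
    rw [Finset.mem_filter, mem_magics] at hB
    obtain ⟨σ, τ, rfl⟩ := hB.1.exists_permSum
    -- Here `k ≥ 2` matters: `σ = τ` would make `σ⁻¹ * τ` the identity, which is not a `k`-cycle.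
    have hne : (σ, τ) ≠ (τ, σ) := by
      rintro h
      obtain rfl : σ = τ := congrArg Prod.fst h
      have := (hmem (σ, σ)).2 hB.2
      simp [P] at this
    rw [← Finset.card_pair hne]
    congr 1
    ext p
    rw [Finset.mem_filter, hmem, Finset.mem_insert, Finset.mem_singleton, Prod.ext_iff,
      Prod.ext_iff]
    constructor
    · rintro ⟨-, h⟩
      exact hB.2.eq_or_eq_swap h
    · intro h
      have h' : permSum p.1 p.2 = permSum σ τ := by
        rcases h with ⟨h3, h4⟩ | ⟨h3, h4⟩
        · rw [h3, h4]
        · rw [h3, h4]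
          ext i j
          exact add_comm _ _
      exact ⟨h' ▸ hB.2, h'⟩
  omega

lemma irrCount_one {r : ℕ} (hr : 0 < r) : irrCount r 1 = 1 := by
  classical
  have hA : IsMagic r (fun _ _ ↦ r : Matrix (Fin 1) (Fin 1) ℕ) :=
    ⟨fun i ↦ by simp, fun j ↦ by simp⟩
  have hU : ∀ S : Finset (Fin 1), S.Nonempty → S = Finset.univ := fun S ⟨i, hi⟩ ↦
    Finset.eq_univ_of_forall fun j ↦ Subsingleton.elim i j ▸ hi
  rw [irrCount, Finset.card_eq_one]
  refine ⟨fun _ _ ↦ r, Finset.eq_singleton_iff_unique_mem.2 ⟨?_, fun A h ↦ ?_⟩⟩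
  · exact Finset.mem_filter.2 ⟨mem_magics.2 hA, hA.isBlock_univ,
      fun S T _ _ h ↦ ⟨hU S h.nonempty, hU T (h.nonempty_cols hr)⟩⟩
  · rw [Finset.mem_filter, mem_magics] at h
    ext i j
    have := h.1.1 i
    rw [Fin.sum_univ_one] at this
    rw [← this, Subsingleton.elim j 0]

end TwoRegular

/-! ### Growth of the number of squares when the dimension increases by one. -/

section Extension

open Equiv

variable {α : Type*} [Fintype α] [DecidableEq α]

/-- The extension of `A` by a row and a column with corner `c` which reroutes the entries of `A`
at the places `(i, σ i)`, `i ∈ R`, through the new row and the new column. -/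
def extend (c : ℕ) (A : Matrix α α ℕ) (σ : Perm α) (R : Finset α) :
    Matrix (Option α) (Option α) ℕ
  | none, none => c
  | none, some j => if σ.symm j ∈ R then 1 else 0
  | some i, none => if i ∈ R then 1 else 0
  | some i, some j => A i j - if i ∈ R ∧ σ i = j then 1 else 0

/-- Each row and column that loses 1 at a place `(i, σ i)` regains it in the new column or row.
Positivity of `A` along `σ` keeps the truncated subtraction exact. -/
lemma isMagic_extend {c : ℕ} {A : Matrix α α ℕ} {σ : Perm α} {R : Finset α}
    (hA : IsMagic (c + R.card) A) (hσ : ∀ i, A i (σ i) ≠ 0) :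
    IsMagic (c + R.card) (extend c A σ R) := by
  have hle : ∀ i j, (if i ∈ R ∧ σ i = j then 1 else 0) ≤ A i j := fun i j ↦ by
    split_ifs with h
    · exact h.2 ▸ Nat.one_le_iff_ne_zero.2 (hσ i)
    · exact Nat.zero_le _
  have h' : ∀ i j, (σ i = j) = (i = σ.symm j) := fun i j ↦ propext σ.eq_symm_apply.symm
  have hsum : ∑ j, (if σ.symm j ∈ R then 1 else 0) = R.card := by
    rw [σ.symm.sum_comp fun i ↦ if i ∈ R then 1 else 0]
    simp
  constructor
  · rintro (_ | i)
    · simp only [Fintype.sum_option, extend, hsum]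
    · simp only [Fintype.sum_option, extend]
      rw [Finset.sum_tsub_distrib _ fun j _ ↦ hle i j]
      have h1 : ∑ j, (if i ∈ R ∧ σ i = j then 1 else 0) = if i ∈ R then 1 else 0 := by
        simp [ite_and]
      have h2 := Finset.sum_le_sum (s := Finset.univ) fun j _ ↦ hle i j
      rw [h1, hA.1 i] at *
      omega
  · rintro (_ | j)
    · simp [Fintype.sum_option, extend]
    · simp only [Fintype.sum_option, extend]
      rw [Finset.sum_tsub_distrib _ fun i _ ↦ hle i j]
      have h1 : ∑ i, (if i ∈ R ∧ σ i = j then 1 else 0) = if σ.symm j ∈ R then 1 else 0 := by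
        simp_rw [h', and_comm (a := _ ∈ R), ite_and]
        simp
      have h2 := Finset.sum_le_sum (s := Finset.univ) fun i _ ↦ hle i j
      rw [h1, hA.2 j] at *
      omega

lemma card_magics_congr {α β γ δ : Type*} [Fintype α] [Fintype β] [Fintype γ] [Fintype δ]
    (r : ℕ) (e : α ≃ β) (f : γ ≃ δ) : (magics β δ r).card = (magics α γ r).card := by
  refine Finset.card_bij' (fun A _ ↦ A.submatrix e f) (fun A _ ↦ A.submatrix e.symm f.symm)
    ?_ ?_ ?_ ?_
  · intro A hA
    rw [mem_magics] at hA ⊢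
    exact hA.submatrix e f
  · intro A hA
    rw [mem_magics] at hA ⊢
    exact hA.submatrix e.symm f.symm
  · intro A _
    simp [Matrix.submatrix_submatrix]
  · intro A _
    simp [Matrix.submatrix_submatrix]

variable (α) in
-- The pairs `(A, R)` with `R.card = s` are mapped by `extend` to squares of the next dimension,
-- with fibres of size at most `s ^ s`.
lemma choose_mul_card_magics_le (c s : ℕ) (hs : 0 < c + s) :
    (Fintype.card α).choose s * (magics α α (c + s)).card ≤
      s ^ s * (magics (Option α) (Option α) (c + s)).card := by
  classical
  have hex : ∀ A : Matrix α α ℕ, ∃ σ : Perm α, IsMagic (c + s) A → ∀ i, A i (σ i) ≠ 0 := fun A ↦ by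
    by_cases hA : IsMagic (c + s) A
    · obtain ⟨σ, hσ⟩ := hA.exists_perm hs
      exact ⟨σ, fun _ ↦ hσ⟩
    · exact ⟨1, fun h ↦ absurd h hA⟩
  choose σ hσ using hex
  rw [← Finset.card_univ, ← Finset.card_powersetCard, mul_comm, ← Finset.card_product]
  refine Finset.card_le_mul_card_image_of_maps_to
    (f := fun p ↦ extend c p.1 (σ p.1) p.2) (fun p hp ↦ ?_) _ fun M hM ↦ ?_
  · rw [Finset.mem_product, mem_magics, Finset.mem_powersetCard_univ] at hp
    obtain ⟨hA, rfl⟩ := hp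
    exact mem_magics.2 (isMagic_extend hA (hσ _ hA))
  · rcases Finset.eq_empty_or_nonempty (((magics α α (c + s)) ×ˢ
      Finset.powersetCard s Finset.univ).filter fun p ↦ extend c p.1 (σ p.1) p.2 = M) with h | h
    · rw [h]
      simp
    obtain ⟨⟨A₀, R₀⟩, h₀⟩ := h
    rw [Finset.mem_filter, Finset.mem_product, Finset.mem_powersetCard_univ] at h₀
    obtain ⟨⟨-, hR₀⟩, rfl⟩ := h₀
    dsimp only at hR₀
    -- The new column of the image reveals `R₀` and the new row reveals its image under `σ`. Hence
    -- `A` is recovered from the restriction of `σ` to `R₀`, a function between two sets of size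
    -- `s`.
    have hfib : ∀ p ∈ ((magics α α (c + s)) ×ˢ Finset.powersetCard s Finset.univ).filter
        (fun p ↦ extend c p.1 (σ p.1) p.2 = extend c A₀ (σ A₀) R₀), IsMagic (c + s) p.1 ∧
        p.2 = R₀ ∧ (∀ j, (σ p.1).symm j ∈ R₀ ↔ (σ A₀).symm j ∈ R₀) ∧
        ∀ i j, p.1 i j = extend c A₀ (σ A₀) R₀ (some i) (some j) +
          if i ∈ R₀ ∧ σ p.1 i = j then 1 else 0 := by
      rintro ⟨A, R⟩ hp
      rw [Finset.mem_filter, Finset.mem_product, mem_magics] at hp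
      obtain ⟨⟨hA, -⟩, heq⟩ := hp
      dsimp only at hA heq ⊢
      have hR : R = R₀ := by
        ext i
        have := congrFun (congrFun heq (some i)) none
        simp only [extend] at this
        split_ifs at this <;> simp_all
      subst hR
      refine ⟨hA, rfl, fun j ↦ ?_, fun i j ↦ ?_⟩
      · have := congrFun (congrFun heq none) (some j)
        simp only [extend] at this
        split_ifs at this <;> simp_all
      · rw [← heq]
        refine (Nat.sub_add_cancel ?_).symm
        split_ifs with h
        · exact h.2 ▸ Nat.one_le_iff_ne_zero.2 (hσ A hA i)
        · exact Nat.zero_le _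
    have hcard : (Fintype.piFinset fun _ : R₀ ↦ R₀.map (σ A₀).toEmbedding).card = s ^ s := by
      simp [hR₀]
    rw [← hcard]
    refine Finset.card_le_card_of_injOn (fun p i ↦ σ p.1 i) (fun p hp ↦ ?_) ?_
    · obtain ⟨-, -, h, -⟩ := hfib p hp
      rw [Finset.mem_coe, Fintype.mem_piFinset]
      intro i
      rw [Finset.mem_map_equiv, ← h, Equiv.symm_apply_apply]
      exact i.2
    · intro p hp q hq hpq
      obtain ⟨-, h1, -, h2⟩ := hfib p hp
      obtain ⟨-, h3, -, h4⟩ := hfib q hq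
      refine Prod.ext ?_ (h1.trans h3.symm)
      ext i j
      rw [h2, h4]
      congr 2
      by_cases hi : i ∈ R₀
      · have := congrFun hpq ⟨i, hi⟩
        dsimp only at this
        rw [this]
      · simp [hi]

end Extension

open scoped Topology

/-! ### Normalized sums: binomial moments and inclusion-exclusion. -/

section Normalized

/-- The number of magical squares of dimension `n`, divided by `(n!)²`. -/
noncomputable def normCard (r n : ℕ) : ℝ :=
  (magics (Fin n) (Fin n) r).card / (n.factorial : ℝ) ^ 2

/-- The sum of a statistic of the block counts over the magical squares of dimension `n`, divided
by `(n!)²`. -/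
noncomputable def normSum (r n : ℕ) (F : (ℕ → ℕ) → ℝ) : ℝ :=
  countSum r n F / (n.factorial : ℝ) ^ 2

/-- The number of irreducible magical squares of dimension `k`, divided by `(k!)²`. -/
noncomputable def irrRate (r k : ℕ) : ℝ := irrCount r k / (k.factorial : ℝ) ^ 2

variable {r : ℕ}

lemma normCard_pos (r n : ℕ) : 0 < normCard r n := by
  have : (magics (Fin n) (Fin n) r).Nonempty :=
    ⟨fun i j ↦ if i = j then r else 0, mem_magics.2 ⟨fun i ↦ by simp, fun j ↦ by simp⟩⟩
  have := this.card_pos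
  rw [normCard]
  positivity

lemma irrRate_nonneg (r k : ℕ) : 0 ≤ irrRate r k := by
  rw [irrRate]
  positivity

lemma normSum_const (r n : ℕ) (c : ℝ) : normSum r n (fun _ ↦ c) = c * normCard r n := by
  rw [normSum, countSum, Finset.sum_const, nsmul_eq_mul, normCard]
  ring

lemma normSum_const_mul (r n : ℕ) (c : ℝ) (F : (ℕ → ℕ) → ℝ) :
    normSum r n (fun x ↦ c * F x) = c * normSum r n F := by
  rw [normSum, countSum, ← Finset.mul_sum, normSum, countSum, mul_div_assoc]

lemma normSum_sum {ι : Type*} (r n : ℕ) (s : Finset ι) (F : ι → (ℕ → ℕ) → ℝ) :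
    normSum r n (fun x ↦ ∑ i ∈ s, F i x) = ∑ i ∈ s, normSum r n (F i) := by
  simp only [normSum, countSum]
  rw [Finset.sum_comm, Finset.sum_div]

lemma normSum_sub (r n : ℕ) (F G : (ℕ → ℕ) → ℝ) :
    normSum r n (fun x ↦ F x - G x) = normSum r n F - normSum r n G := by
  rw [normSum, countSum, Finset.sum_sub_distrib, sub_div]
  rfl

/-- Statistics need only agree on sequences that can occur as block counts, which satisfy `∑ k * x k
= n`. -/
lemma normSum_congr (hr : 0 < r) {n : ℕ} {F G : (ℕ → ℕ) → ℝ}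
    (h : ∀ x : ℕ → ℕ, ∑ k ∈ Finset.range (n + 1), k * x k = n → (∀ k, k * x k ≤ n) → F x = G x) :
    normSum r n F = normSum r n G := by
  rw [normSum, normSum, countSum, countSum]
  congr 1
  refine Finset.sum_congr rfl fun A hA ↦ ?_
  have hsum := (mem_magics.1 hA).sum_mul_blockCount hr
  rw [Fintype.card_fin] at hsum
  refine h _ hsum fun k ↦ ?_
  rcases Nat.lt_or_ge n k with hk | hk
  · simp [blockCount_eq_zero_of_lt hk]
  · exact (Finset.single_le_sum (f := fun k ↦ k * blockCount r A k) (fun _ _ ↦ Nat.zero_le _)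
      (Finset.mem_range.2 (Nat.lt_succ_of_le hk))).trans hsum.le

lemma abs_normSum_le {n : ℕ} {F G : (ℕ → ℕ) → ℝ} (h : ∀ x, |F x| ≤ G x) :
    |normSum r n F| ≤ normSum r n G := by
  rw [normSum, normSum, countSum, countSum, abs_div, abs_of_nonneg (a := _ ^ 2) (by positivity)]
  gcongr
  exact (Finset.abs_sum_le_sum_abs _ _).trans (Finset.sum_le_sum fun A _ ↦ h _)

lemma normSum_apply_mul (hr : 0 < r) (k m : ℕ) (F : (ℕ → ℕ) → ℝ) :
    normSum r (k + m) (fun x ↦ x k * F x) =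
      irrRate r k * normSum r m (fun x ↦ F (x + Pi.single k 1)) := by
  rw [normSum, countSum_blockCount_mul hr, irrRate, normSum]
  have h : ((k + m).factorial : ℝ) = (k + m).choose k * k.factorial * m.factorial := by
    rw [Nat.choose_symm_add]
    exact_mod_cast (Nat.add_choose_mul_factorial_mul_factorial k m).symm
  have h1 : ((k + m).choose k : ℝ) ≠ 0 := by
    exact_mod_cast (Nat.choose_pos (Nat.le_add_right k m)).ne'
  rw [h]
  field_simp

lemma normSum_choose_mul_add (hr : 0 < r) (k s m : ℕ) (F : (ℕ → ℕ) → ℝ) :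
    normSum r (k * s + m) (fun x ↦ (x k).choose s * F x) =
      irrRate r k ^ s / s.factorial * normSum r m (fun x ↦ F (x + Pi.single k s)) := by
  induction s generalizing F with
  | zero => simp
  | succ s ih =>
    -- The absorption identity peels off one factor `x k`, that is, one component; the rest is a
    -- binomial in `x k - 1`, which the shift by `Pi.single k 1` restores to `x k`.
    have h1 : ∀ x : ℕ → ℕ, ((x k).choose (s + 1) : ℝ) * F x =
        ((s + 1 : ℕ) : ℝ)⁻¹ * (x k * (((x k - 1).choose s : ℝ) * F x)) := fun x ↦ by
      rcases Nat.eq_zero_or_pos (x k) with h | h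
      · simp [h]
      · obtain ⟨y, hy⟩ := Nat.exists_eq_add_of_lt h
        have := Nat.add_one_mul_choose_eq y s
        rw [zero_add] at hy
        rw [hy, Nat.add_sub_cancel, eq_inv_mul_iff_mul_eq₀ (by positivity), ← mul_assoc,
          ← mul_assoc]
        congr 1
        rw [mul_comm]
        exact_mod_cast this.symm
    have h2 : k * (s + 1) + m = k + (k * s + m) := by ring
    simp only [h1]
    rw [normSum_const_mul, h2, normSum_apply_mul hr]
    have h3 : ∀ x : ℕ → ℕ, (((x + Pi.single k 1 : ℕ → ℕ) k - 1).choose s : ℝ) *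
        F (x + Pi.single k 1) = (x k).choose s * F (x + Pi.single k 1) := fun x ↦ by
      simp
    simp only [h3]
    rw [ih]
    have h4 : ∀ x : ℕ → ℕ, x + Pi.single k s + Pi.single k 1 = x + Pi.single k (s + 1) :=
      fun x ↦ by rw [add_assoc, ← Pi.single_add]
    simp only [h4]
    rw [Nat.factorial_succ, pow_succ]
    push_cast
    field_simp

/-- `normSum r (n - j) F`, and `0` if `j > n`. -/
noncomputable def shiftSum (r n j : ℕ) (F : (ℕ → ℕ) → ℝ) : ℝ :=
  if j ≤ n then normSum r (n - j) F else 0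

lemma normSum_choose_mul (hr : 0 < r) (n k s : ℕ) (F : (ℕ → ℕ) → ℝ) :
    normSum r n (fun x ↦ (x k).choose s * F x) =
      irrRate r k ^ s / s.factorial * shiftSum r n (k * s) (fun x ↦ F (x + Pi.single k s)) := by
  rw [shiftSum]
  split_ifs with h
  · obtain ⟨m, rfl⟩ := Nat.exists_eq_add_of_le h
    rw [normSum_choose_mul_add hr, Nat.add_sub_cancel_left]
  · rw [mul_zero, normSum_congr hr (G := fun _ ↦ 0), normSum_const, zero_mul]
    intro x _ hx
    have hlt : x k < s := by
      by_contra! hs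
      exact h ((Nat.mul_le_mul_left k hs).trans (hx k))
    rw [Nat.choose_eq_zero_of_lt hlt, Nat.cast_zero, zero_mul]

/-- On `x k = t` the binomial `(x k).choose t` equals 1, so it can be inserted for free. Removing
those `t` components leaves the event `x k = 0`. -/
lemma normSum_ite_eq (hr : 0 < r) (n k t : ℕ) (F : (ℕ → ℕ) → ℝ)
    (hF : ∀ x s, F (x + Pi.single k s) = F x) :
    normSum r n (fun x ↦ (if x k = t then 1 else 0) * F x) =
      irrRate r k ^ t / t.factorial *
        shiftSum r n (k * t) (fun x ↦ (if x k = 0 then 1 else 0) * F x) := by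
  have h1 : ∀ x : ℕ → ℕ, (if x k = t then (1 : ℝ) else 0) * F x =
      (x k).choose t * ((if x k = t then 1 else 0) * F x) := fun x ↦ by
    split_ifs with h
    · simp [h]
    · simp
  rw [funext h1]
  rw [normSum_choose_mul hr]
  simp only [hF, Pi.add_apply, Pi.single_eq_same, Nat.add_eq_right]

/-- Inclusion-exclusion: `∑ (-1) ^ s * (x k).choose s` is the indicator of `x k = 0`. Terms with `k
* s > n` vanish; the infinite-series form has an index set independent of `n`, as dominated
convergence requires. -/
lemma hasSum_normSum_ite_eq_zero (hr : 0 < r) (n : ℕ) {k : ℕ} (hk : 0 < k) (F : (ℕ → ℕ) → ℝ)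
    (hF : ∀ x s, F (x + Pi.single k s) = F x) :
    HasSum (fun s : ℕ ↦ (-irrRate r k) ^ s / s.factorial * shiftSum r n (k * s) F)
      (normSum r n (fun x ↦ (if x k = 0 then 1 else 0) * F x)) := by
  have h1 : normSum r n (fun x ↦ (if x k = 0 then 1 else 0) * F x) =
      ∑ s ∈ Finset.range (n + 1),
        (-irrRate r k) ^ s / s.factorial * shiftSum r n (k * s) F := by
    have h2 : ∀ s, (-irrRate r k) ^ s / s.factorial * shiftSum r n (k * s) F =
        normSum r n (fun x ↦ (-1) ^ s * ((x k).choose s * F x)) := fun s ↦ by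
      rw [normSum_const_mul, normSum_choose_mul hr]
      simp only [hF]
      rw [neg_pow]
      ring
    simp only [h2]
    rw [← normSum_sum]
    refine normSum_congr hr fun x _ hx ↦ ?_
    have hxk : x k ≤ n := (Nat.le_mul_of_pos_left _ hk).trans (hx k)
    have h3 := Int.alternating_sum_range_choose (n := x k)
    have h4 : ∑ s ∈ Finset.range (n + 1), ((-1) ^ s * ((x k).choose s : ℤ)) =
        if x k = 0 then 1 else 0 := by
      rw [← h3]
      refine (Finset.sum_subset (Finset.range_subset_range.2 (by omega)) fun s _ hs ↦ ?_).symm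
      rw [Finset.mem_range, not_lt] at hs
      rw [Nat.choose_eq_zero_of_lt (by omega)]
      simp
    have h5 : (∑ s ∈ Finset.range (n + 1), ((-1) ^ s * ((x k).choose s : ℝ))) =
        if x k = 0 then 1 else 0 := by exact_mod_cast h4
    rw [← h5, Finset.sum_mul]
    exact Finset.sum_congr rfl fun s _ ↦ by ring
  rw [h1]
  refine hasSum_sum_of_ne_finset_zero fun s hs ↦ ?_
  rw [Finset.mem_range, not_lt] at hs
  rw [shiftSum, if_neg, mul_zero]
  have := Nat.le_mul_of_pos_left s hk
  omega

end Normalized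

/-! ### Limits of the normalized sums in the two regimes of the ratio. -/

section Limits

variable {r : ℕ}

lemma normCard_sub_le (h2 : ∀ n, normCard r n ≤ 2 * normCard r (n + 1)) {n j : ℕ} (hj : j ≤ n) :
    normCard r (n - j) ≤ 2 ^ j * normCard r n := by
  obtain ⟨m, rfl⟩ := Nat.exists_eq_add_of_le hj
  rw [Nat.add_sub_cancel_left]
  clear hj
  induction j with
  | zero => simp
  | succ j ih =>
    refine ih.trans ?_
    rw [pow_succ, mul_assoc, add_right_comm]
    gcongr
    exact h2 _

lemma abs_normSum_le_normCard {n : ℕ} {F : (ℕ → ℕ) → ℝ} (hF : ∀ x, |F x| ≤ 1) :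
    |normSum r n F| ≤ normCard r n := by
  refine (abs_normSum_le hF).trans_eq ?_
  rw [normSum_const, one_mul]

lemma abs_shiftSum_div_le (h2 : ∀ n, normCard r n ≤ 2 * normCard r (n + 1)) (n j : ℕ)
    {F : (ℕ → ℕ) → ℝ} (hF : ∀ x, |F x| ≤ 1) : |shiftSum r n j F / normCard r n| ≤ 2 ^ j := by
  rw [abs_div, abs_of_pos (normCard_pos r n), div_le_iff₀ (normCard_pos r n), shiftSum]
  split_ifs with h
  · exact (abs_normSum_le_normCard hF).trans (normCard_sub_le h2 h)
  · have := normCard_pos r n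
    rw [abs_zero]
    positivity

lemma tendsto_normCard_div_add
    (hlim : Tendsto (fun n ↦ normCard r n / normCard r (n + 1)) atTop (𝓝 1)) (j : ℕ) :
    Tendsto (fun n ↦ normCard r n / normCard r (n + j)) atTop (𝓝 1) := by
  induction j with
  | zero => simp [div_self (normCard_pos r _).ne']
  | succ j ih =>
    have h := ih.mul (hlim.comp (tendsto_add_atTop_nat j))
    rw [mul_one] at h
    refine h.congr fun n ↦ ?_
    have := (normCard_pos r (n + j)).ne'
    simp only [Function.comp_apply]
    rw [div_mul_div_cancel₀ this, add_assoc]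

/-- Since `normCard r (n - j) / normCard r n` tends to 1, removing boundedly many rows does not
change the limit. -/
lemma tendsto_shiftSum_div
    (hlim : Tendsto (fun n ↦ normCard r n / normCard r (n + 1)) atTop (𝓝 1))
    {F : (ℕ → ℕ) → ℝ} {L : ℝ}
    (hL : Tendsto (fun n ↦ normSum r n F / normCard r n) atTop (𝓝 L)) (j : ℕ) :
    Tendsto (fun n ↦ shiftSum r n j F / normCard r n) atTop (𝓝 L) := by
  rw [← tendsto_add_atTop_iff_nat j]
  have h := hL.mul (tendsto_normCard_div_add hlim j)
  rw [mul_one] at h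
  refine h.congr fun n ↦ ?_
  rw [shiftSum, if_pos (Nat.le_add_left j n), Nat.add_sub_cancel,
    div_mul_div_cancel₀ (normCard_pos r n).ne']

/-- Under the hypothesis that consecutive normalized numbers of magical squares are asymptotically
equal, the number of irreducible `k`-components is asymptotically Poisson and independent of any
bounded statistic of the other component counts. -/
lemma tendsto_normSum_ite_eq (hr : 0 < r) (h2 : ∀ n, normCard r n ≤ 2 * normCard r (n + 1))
    (hlim : Tendsto (fun n ↦ normCard r n / normCard r (n + 1)) atTop (𝓝 1))
    {k : ℕ} (hk : 0 < k) {F : (ℕ → ℕ) → ℝ} (hF1 : ∀ x, |F x| ≤ 1)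
    (hF : ∀ x s, F (x + Pi.single k s) = F x) {L : ℝ}
    (hL : Tendsto (fun n ↦ normSum r n F / normCard r n) atTop (𝓝 L)) (t : ℕ) :
    Tendsto (fun n ↦ normSum r n (fun x ↦ (if x k = t then 1 else 0) * F x) / normCard r n) atTop
      (𝓝 (Real.exp (-irrRate r k) * irrRate r k ^ t / t.factorial * L)) := by
  have hzero : Tendsto (fun n ↦ normSum r n (fun x ↦ (if x k = 0 then 1 else 0) * F x) /
      normCard r n) atTop (𝓝 (Real.exp (-irrRate r k) * L)) := by
    have hexp : HasSum (fun s : ℕ ↦ (-irrRate r k) ^ s / s.factorial * L)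
        (Real.exp (-irrRate r k) * L) := by
      rw [Real.exp_eq_exp_ℝ]
      exact (NormedSpace.expSeries_div_hasSum_exp (-irrRate r k)).mul_right L
    rw [← hexp.tsum_eq]
    have hsum : ∀ n, normSum r n (fun x ↦ (if x k = 0 then 1 else 0) * F x) / normCard r n =
        ∑' s : ℕ, (-irrRate r k) ^ s / s.factorial *
          (shiftSum r n (k * s) F / normCard r n) := fun n ↦ by
      rw [← ((hasSum_normSum_ite_eq_zero hr n hk F hF).div_const _).tsum_eq]
      simp only [mul_div_assoc]
    simp only [hsum]
    -- Removing `k * s` rows costs at most `2 ^ (k * s)` by `h2`, and `1 / s!` beats this geometric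
    -- growth.
    refine tendsto_tsum_of_dominated_convergence
      (bound := fun s ↦ (irrRate r k * 2 ^ k) ^ s / s.factorial)
      (Real.summable_pow_div_factorial _) (fun s ↦ (tendsto_shiftSum_div hlim hL _).const_mul _)
      (Eventually.of_forall fun n s ↦ ?_)
    rw [Real.norm_eq_abs, abs_mul, abs_div, abs_pow, abs_neg, abs_of_nonneg (irrRate_nonneg r k),
      abs_of_nonneg (a := (s.factorial : ℝ)) (by positivity), mul_pow, ← pow_mul, mul_div_right_comm]
    have := irrRate_nonneg r k
    gcongr
    exact abs_shiftSum_div_le h2 _ _ hF1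
  have h := (tendsto_shiftSum_div hlim hzero (k * t)).const_mul
    (irrRate r k ^ t / t.factorial)
  have hlimit : Real.exp (-irrRate r k) * irrRate r k ^ t / t.factorial * L =
      irrRate r k ^ t / t.factorial * (Real.exp (-irrRate r k) * L) := by ring
  rw [hlimit]
  refine h.congr fun n ↦ ?_
  rw [normSum_ite_eq hr n k t F hF, mul_div_assoc]

/-- Sum the identity `∑ k * x k = n` over all squares, and remove one component of each size. -/
lemma sum_mul_irrRate_mul_normCard (hr : 0 < r) (n : ℕ) :
    ∑ k ∈ Finset.range (n + 1), k * (irrRate r k * normCard r (n - k)) = n * normCard r n := by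
  rw [← normSum_const, ← normSum_congr hr (F := fun x ↦
    ∑ k ∈ Finset.range (n + 1), (k : ℝ) * (x k * 1)) (fun x hx _ ↦ by
      rw [← Nat.cast_inj (R := ℝ)] at hx
      push_cast at hx
      simpa using hx), normSum_sum]
  refine Finset.sum_congr rfl fun k hk ↦ ?_
  obtain ⟨m, rfl⟩ := Nat.exists_eq_add_of_le (Nat.lt_succ_iff.1 (Finset.mem_range.1 hk))
  rw [normSum_const_mul, normSum_apply_mul hr, normSum_const, one_mul, Nat.add_sub_cancel_left]

lemma irrRate_one (hr : 0 < r) : irrRate r 1 = 1 := by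
  simp [irrRate, irrCount_one hr]

lemma irrRate_two {k : ℕ} (hk : 2 ≤ k) : irrRate 2 k = 1 / (2 * k) := by
  have h := two_mul_irrCount_two hk
  rw [irrRate]
  obtain ⟨m, rfl⟩ := Nat.exists_eq_add_of_le hk
  have h1 : (2 + m - 1) = m + 1 := by omega
  have h2 : 2 + m = m + 1 + 1 := by omega
  rw [h1, h2, Nat.factorial_succ (m + 1)] at h
  rw [h2, Nat.factorial_succ (m + 1)]
  have h3 : 2 * (irrCount 2 (m + 1 + 1) : ℝ) =
      ((m + 1 + 1 : ℕ) * (m + 1).factorial : ℝ) * (m + 1).factorial := by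
    exact_mod_cast h
  have h4 : ((m + 1).factorial : ℝ) ≠ 0 := by positivity
  push_cast at h3 ⊢
  rw [div_eq_div_iff (by positivity) (by positivity)]
  linear_combination (m + 1 + 1 : ℝ) * h3

/-- The weight `k * irrRate 2 k` is 1 for `k = 1` and the constant `1 / 2` for `k ≥ 2`. Hence
differencing consecutive instances eliminates the sum and gives the three-term recurrence
`normCard_two_add_two`. -/
lemma add_one_mul_normCard_two (n : ℕ) : (n + 1) * normCard 2 (n + 1) =
    normCard 2 n + 1 / 2 * ∑ i ∈ Finset.range n, normCard 2 i := by
  have h := sum_mul_irrRate_mul_normCard (r := 2) two_pos (n + 1)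
  rw [Finset.sum_range_succ', Finset.sum_range_succ'] at h
  have h1 : ∀ k ∈ Finset.range n, ((k + 1 + 1 : ℕ) : ℝ) *
      (irrRate 2 (k + 1 + 1) * normCard 2 (n + 1 - (k + 1 + 1))) =
      1 / 2 * normCard 2 (n - 1 - k) := fun k _ ↦ by
    rw [irrRate_two (by omega), show n + 1 - (k + 1 + 1) = n - 1 - k by omega]
    have : ((k + 1 + 1 : ℕ) : ℝ) ≠ 0 := by positivity
    field_simp
  rw [Finset.sum_congr rfl h1, ← Finset.mul_sum, Finset.sum_range_reflect] at h
  simp only [zero_add, irrRate_one two_pos, Nat.add_sub_cancel] at h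
  push_cast at h
  linarith

lemma normCard_two_add_two (n : ℕ) : normCard 2 (n + 2) =
    normCard 2 (n + 1) - normCard 2 n / (2 * (n + 2)) := by
  have h1 := add_one_mul_normCard_two n
  have h2 := add_one_mul_normCard_two (n + 1)
  rw [Finset.sum_range_succ] at h2
  push_cast at h2
  have h3 : (n + 2 : ℝ) ≠ 0 := by positivity
  field_simp
  rw [show n + 1 + 1 = n + 2 from rfl] at h2
  linarith

lemma normCard_two_le (n : ℕ) : normCard 2 n ≤ 2 * normCard 2 (n + 1) := by
  induction n with
  | zero =>
    have := add_one_mul_normCard_two 0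
    have := normCard_pos 2 0
    simp at *
    linarith
  | succ n ih =>
    rw [show n + 1 + 1 = n + 2 from rfl, normCard_two_add_two]
    have h := normCard_pos 2 (n + 1)
    have : normCard 2 n / (2 * (n + 2)) ≤ normCard 2 (n + 1) / 2 := by
      rw [div_le_div_iff₀ (by positivity) (by positivity)]
      have : (0 : ℝ) ≤ n := by positivity
      nlinarith
    linarith

lemma tendsto_normCard_two :
    Tendsto (fun n ↦ normCard 2 n / normCard 2 (n + 1)) atTop (𝓝 1) := by
  rw [← tendsto_add_atTop_iff_nat 1]
  -- By the recurrence `normCard 2` is non-increasing from 1 on, which bounds the ratio below by 1.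
  -- Two uses of `normCard_two_le` bound the decrement by `4 * normCard 2 (n + 2) / (2 * (n + 2))`.
  refine tendsto_of_tendsto_of_tendsto_of_le_of_le (tendsto_const_nhds (x := (1 : ℝ)))
    (h := fun n : ℕ ↦ 1 + 2 * (1 / ((n : ℝ) + 1))) ?_ (fun n ↦ ?_) (fun n ↦ ?_)
  · simpa using (tendsto_one_div_add_atTop_nhds_zero_nat (𝕜 := ℝ)).const_mul 2 |>.const_add 1
  · have h := normCard_two_add_two n
    have h0 := normCard_pos 2 n
    have : 0 ≤ normCard 2 n / (2 * (n + 2)) := by positivity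
    dsimp only
    rw [show n + 1 + 1 = n + 2 from rfl, one_le_div (normCard_pos 2 _)]
    linarith
  · have h := normCard_two_add_two n
    have h1 := normCard_two_le n
    have h2 := normCard_two_le (n + 1)
    have h0 := normCard_pos 2 (n + 2)
    have : normCard 2 n / (2 * (n + 2)) ≤ 2 * (1 / ((n : ℝ) + 1)) * normCard 2 (n + 2) := by
      rw [mul_one_div, div_mul_eq_mul_div, div_le_div_iff₀ (by positivity) (by positivity)]
      have hn : (0 : ℝ) ≤ n := by positivity
      have h3 : normCard 2 n ≤ 4 * normCard 2 (n + 2) := by linarith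
      calc normCard 2 n * (n + 1) ≤ 4 * normCard 2 (n + 2) * (n + 2) := by gcongr; linarith
        _ = 2 * normCard 2 (n + 2) * (2 * (n + 2)) := by ring
    dsimp only
    rw [show n + 1 + 1 = n + 2 from rfl, div_le_iff₀ h0]
    linarith

/-- Rerouting three entries gives a factor of order `n³` in the number of squares, whereas `((n +
1)!)² / (n!)²` is only of order `n²`. -/
lemma tendsto_normCard_div_zero (hr : 3 ≤ r) :
    Tendsto (fun n ↦ normCard r n / normCard r (n + 1)) atTop (𝓝 0) := by
  obtain ⟨c, rfl⟩ := Nat.exists_eq_add_of_le' hr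
  rw [← tendsto_add_atTop_iff_nat 3]
  -- `486 = 27 * 6 * 3`: the fibre bound `3 ^ 3`, the `3!` from the binomial, and `(n + 4) ^ 2 ≤ 3 *
  -- ((n + 3) * (n + 2))`.
  refine squeeze_zero (g := fun n : ℕ ↦ 486 * (1 / ((n : ℝ) + 1)))
    (fun n ↦ (div_pos (normCard_pos _ _) (normCard_pos _ _)).le) (fun n ↦ ?_) ?_
  · have h1 := choose_mul_card_magics_le (Fin (n + 3)) c 3 (by omega)
    rw [Fintype.card_fin, card_magics_congr _ (finSuccEquiv (n + 3)) (finSuccEquiv (n + 3))] at h1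
    have h2 : ((n + 3) * (n + 2) * (n + 1) : ℝ) = 6 * (n + 3).choose 3 := by
      have := Nat.descFactorial_eq_factorial_mul_choose (n + 3) 3
      simp only [Nat.descFactorial_succ, Nat.descFactorial_zero, Nat.factorial] at this
      rw [show n + 3 - 2 = n + 1 by omega, show n + 3 - 1 = n + 2 by omega] at this
      have h : ((n + 3) * (n + 2) * (n + 1) : ℕ) = 6 * (n + 3).choose 3 := by
        rw [← show Nat.succ 2 * (Nat.succ 1 * (Nat.succ 0 * 1)) = 6 from rfl, ← this, Nat.sub_zero]
        ring
      exact_mod_cast h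
    have h3 : ((n + 3).choose 3 : ℝ) * (magics (Fin (n + 3)) (Fin (n + 3)) (c + 3)).card ≤
        27 * (magics (Fin (n + 3 + 1)) (Fin (n + 3 + 1)) (c + 3)).card := by exact_mod_cast h1
    rw [mul_one_div, div_le_div_iff₀ (normCard_pos _ _) (by positivity), normCard, normCard,
      Nat.factorial_succ (n + 3)]
    obtain ⟨a, ha⟩ : ∃ a, a = (magics (Fin (n + 3)) (Fin (n + 3)) (c + 3)).card := ⟨_, rfl⟩
    obtain ⟨b, hb⟩ : ∃ b, b = (magics (Fin (n + 3 + 1)) (Fin (n + 3 + 1)) (c + 3)).card := ⟨_, rfl⟩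
    rw [← ha, ← hb] at h3 ⊢
    have h4 : ((n + 3) * (n + 2) * (n + 1) : ℝ) * a ≤ 162 * b := by
      rw [h2]
      linarith
    have hn : (0 : ℝ) ≤ n := by positivity
    have h5 : ((n : ℝ) + 4) ^ 2 ≤ 3 * ((n + 3) * (n + 2)) := by nlinarith
    push_cast
    rw [div_mul_eq_mul_div, mul_div_assoc', div_le_div_iff₀ (by positivity) (by positivity)]
    generalize ((n + 3).factorial : ℝ) = f
    calc (a * (n + 1) : ℝ) * ((n + 3 + 1) * f) ^ 2
        = (((n : ℝ) + 4) ^ 2 * (a * (n + 1))) * f ^ 2 := by ring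
      _ ≤ ((3 * ((n + 3) * (n + 2))) * (a * (n + 1))) * f ^ 2 := by gcongr
      _ = 3 * ((n + 3) * (n + 2) * (n + 1) * a) * f ^ 2 := by ring
      _ ≤ 3 * (162 * b) * f ^ 2 := by gcongr
      _ = 486 * b * f ^ 2 := by ring
  · simpa using (tendsto_one_div_add_atTop_nhds_zero_nat (𝕜 := ℝ)).const_mul 486

lemma tendsto_normCard_div_add_zero
    (hlim : Tendsto (fun n ↦ normCard r n / normCard r (n + 1)) atTop (𝓝 0)) (j : ℕ) :
    Tendsto (fun n ↦ normCard r n / normCard r (n + (j + 1))) atTop (𝓝 0) := by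
  induction j with
  | zero => simpa using hlim
  | succ j ih =>
    have h := ih.mul (hlim.comp (tendsto_add_atTop_nat (j + 1)))
    rw [mul_zero] at h
    refine h.congr fun n ↦ ?_
    have := (normCard_pos r (n + (j + 1))).ne'
    simp only [Function.comp_apply]
    rw [div_mul_div_cancel₀ this, add_assoc n (j + 1) 1]

/-- The mean number of `k`-components in dimension `n + k` is exactly `irrRate r k * normCard r n /
normCard r (n + k)`. -/
lemma tendsto_normSum_apply_zero (hr : 0 < r)
    (hlim : Tendsto (fun n ↦ normCard r n / normCard r (n + 1)) atTop (𝓝 0)) {k : ℕ}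
    (hk : 0 < k) : Tendsto (fun n ↦ normSum r n (fun x ↦ x k) / normCard r n) atTop (𝓝 0) := by
  rw [← tendsto_add_atTop_iff_nat k]
  obtain ⟨j, rfl⟩ := Nat.exists_eq_add_one.2 hk
  have h := (tendsto_normCard_div_add_zero hlim j).const_mul (irrRate r (j + 1))
  rw [mul_zero] at h
  refine h.congr fun n ↦ ?_
  have := normSum_apply_mul hr (j + 1) n (fun _ ↦ 1)
  simp only [mul_one, normSum_const, one_mul] at this
  rw [add_comm n, this, mul_div_assoc]

lemma tendsto_normSum_ite_eq_of_tendsto_zero (hr : 0 < r)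
    (hlim : Tendsto (fun n ↦ normCard r n / normCard r (n + 1)) atTop (𝓝 0))
    {k : ℕ} (hk : 0 < k) {F : (ℕ → ℕ) → ℝ} (hF1 : ∀ x, |F x| ≤ 1) {L : ℝ}
    (hL : Tendsto (fun n ↦ normSum r n F / normCard r n) atTop (𝓝 L)) (t : ℕ) :
    Tendsto (fun n ↦ normSum r n (fun x ↦ (if x k = t then 1 else 0) * F x) / normCard r n) atTop
      (𝓝 ((if t = 0 then 1 else 0) * L)) := by
  have h0 : Tendsto (fun n ↦ normSum r n (fun x ↦ (if x k = t then 1 else 0) * F x) /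
      normCard r n - (if t = 0 then 1 else 0) * (normSum r n F / normCard r n)) atTop (𝓝 0) := by
    -- First-moment bound: the indicators of `x k = t` and of `t = 0` differ only if `x k ≥ 1`, so
    -- their difference is at most `x k` in absolute value.
    refine squeeze_zero_norm (fun n ↦ ?_) (tendsto_normSum_apply_zero hr hlim hk)
    rw [Real.norm_eq_abs, ← mul_div_assoc, ← normSum_const_mul, ← sub_div, ← normSum_sub, abs_div,
      abs_of_pos (normCard_pos r n)]
    refine div_le_div_of_nonneg_right (abs_normSum_le fun x ↦ ?_) (normCard_pos r n).le
    rcases Nat.eq_zero_or_pos (x k) with h | h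
    · rcases Nat.eq_zero_or_pos t with ht | ht
      · simp [h, ht]
      · simp [h, ht.ne, ht.ne']
    · have h1 : (1 : ℝ) ≤ x k := by exact_mod_cast h
      refine le_trans ?_ h1
      refine le_trans ?_ (hF1 x)
      rcases Nat.eq_zero_or_pos t with ht | ht
      · simp [h.ne', ht]
      · by_cases hxt : x k = t <;> simp [hxt, ht.ne']
  have := h0.add (hL.const_mul (if t = 0 then (1 : ℝ) else 0))
  simpa using this

/-- Successive conditioning on finitely many coordinates. -/
lemma tendsto_normSum_prod {q : ℕ+ → ℕ → ℝ}
    (h : ∀ (k : ℕ+) (F : (ℕ → ℕ) → ℝ) (L : ℝ), (∀ x, |F x| ≤ 1) →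
      (∀ x s, F (x + Pi.single (k : ℕ) s) = F x) →
      Tendsto (fun n ↦ normSum r n F / normCard r n) atTop (𝓝 L) → ∀ t,
      Tendsto (fun n ↦ normSum r n (fun x ↦ (if x k = t then 1 else 0) * F x) / normCard r n)
        atTop (𝓝 (q k t * L)))
    (s : Finset ℕ+) (m : ℕ+ → ℕ) :
    Tendsto (fun n ↦ normSum r n (fun x ↦ ∏ k ∈ s, if x k = m k then 1 else 0) / normCard r n)
      atTop (𝓝 (∏ k ∈ s, q k (m k))) := by
  induction s using Finset.induction_on with
  | empty => simp [normSum_const, div_self (normCard_pos r _).ne']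
  | insert k s hk ih =>
    simp only [Finset.prod_insert hk]
    refine h k _ _ (fun x ↦ ?_) (fun x t ↦ ?_) ih (m k)
    · rw [Finset.abs_prod]
      exact Finset.prod_le_one (fun _ _ ↦ abs_nonneg _) fun _ _ ↦ by split_ifs <;> simp
    · refine Finset.prod_congr rfl fun j hj ↦ ?_
      have : (j : ℕ) ≠ k := fun hjk ↦ hk (PNat.coe_injective hjk ▸ hj)
      simp [Pi.single_eq_of_ne this]

end Limits

/-! ### From normalized sums to probabilities of cylinders and weak convergence. -/

section Probability

variable {r n : ℕ}

lemma isKComponent_iff (hr : 0 < r) {A : Matrix (Fin n) (Fin n) ℕ} {k : ℕ}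
    {S T : Finset (Fin n)} : IsKComponent r A k S T ↔ IsBlock r A S T ∧ S.card = k :=
  ⟨fun h ↦ ⟨⟨h.nonempty_rows, h.row_sum, h.col_sum⟩, h.card_rows⟩,
    fun h ↦ ⟨h.1.nonempty, h.1.nonempty_cols hr, h.2, h.1.card_eq hr ▸ h.2, h.1.row_sum,
      h.1.col_sum⟩⟩

lemma isComponent_iff (hr : 0 < r) {A : Matrix (Fin n) (Fin n) ℕ} {S T : Finset (Fin n)} :
    IsComponent r A S T ↔ IsBlock r A S T := by
  simp [IsComponent, isKComponent_iff hr]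

lemma componentCount_eq_blockCount (hr : 0 < r) (A : Matrix (Fin n) (Fin n) ℕ) (k : ℕ) :
    componentCount r A k = blockCount r A k := by
  rw [componentCount, blockCount, ← Set.ncard_coe_finset]
  congr 1
  ext p
  simp only [Set.mem_ofPred_eq, IsIrreducibleKComponent, isKComponent_iff hr, isComponent_iff hr,
    Finset.coe_filter, mem_irrBlocks, IsIrrBlock]
  tauto

lemma magicalSquares_eq (n r : ℕ) : magicalSquares n r = magics (Fin n) (Fin n) r := by
  ext A
  rw [Finset.mem_coe, mem_magics]
  rfl

lemma uniformOn_real_cylinder (hr : 0 < r) (s : Finset ℕ+) (m : ℕ+ → ℕ) :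
    (uniformOn (magicalSquares n r)).real
      ((fun M (k : ℕ+) ↦ componentCount r M (k : ℕ)) ⁻¹' {x | ∀ k ∈ s, x k = m k}) =
      normSum r n (fun x ↦ ∏ k ∈ s, if x k = m k then 1 else 0) / normCard r n := by
  classical
  have hset : (magics (Fin n) (Fin n) r : Set (Matrix (Fin n) (Fin n) ℕ)) ∩
      ((fun M (k : ℕ+) ↦ componentCount r M (k : ℕ)) ⁻¹' {x | ∀ k ∈ s, x k = m k}) =
      ((magics (Fin n) (Fin n) r).filter fun M ↦ ∀ k ∈ s, blockCount r M k = m k :) := by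
    ext M
    simp [componentCount_eq_blockCount hr]
  rw [measureReal_def, magicalSquares_eq, ← uniformOn_inter_self (Finset.finite_toSet _), hset,
    uniformOn_apply_finset, Finset.inter_eq_right.2 (Finset.filter_subset _ _), normSum, normCard,
    div_div_div_cancel_right₀ (by positivity), ENNReal.toReal_div, ENNReal.toReal_natCast,
    ENNReal.toReal_natCast, countSum]
  simp_rw [Finset.prod_boole]
  rw [Finset.sum_boole]

lemma isPiSystem_cylinders :
    IsPiSystem {C : Set (ℕ+ → ℕ) | ∃ (s : Finset ℕ+) (m : ℕ+ → ℕ), C = {x | ∀ k ∈ s, x k = m k}} := by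
  classical
  rintro _ ⟨s, m, rfl⟩ _ ⟨s', m', rfl⟩ ⟨x, hx, hx'⟩
  -- A point of the intersection prescribes values compatible with both cylinders.
  refine ⟨s ∪ s', x, ?_⟩
  ext y
  simp only [Set.mem_inter_iff, Set.mem_ofPred_eq, Finset.mem_union] at hx hx' ⊢
  constructor
  · rintro ⟨h, h'⟩ k (hk | hk)
    · rw [h k hk, hx k hk]
    · rw [h' k hk, hx' k hk]
  · intro h
    exact ⟨fun k hk ↦ (h k (Or.inl hk)).trans (hx k hk),
      fun k hk ↦ (h k (Or.inr hk)).trans (hx' k hk)⟩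

/-- Weak convergence on `ℕ+ → ℕ` follows from convergence of the probabilities of cylinders. -/
lemma tendsto_of_tendsto_cylinders {μ : ℕ → ProbabilityMeasure (ℕ+ → ℕ)}
    {ν : ProbabilityMeasure (ℕ+ → ℕ)}
    (h : ∀ (s : Finset ℕ+) (m : ℕ+ → ℕ), Tendsto
      (fun n ↦ (μ n : Measure (ℕ+ → ℕ)).real {x | ∀ k ∈ s, x k = m k}) atTop
      (𝓝 ((ν : Measure (ℕ+ → ℕ)).real {x | ∀ k ∈ s, x k = m k}))) :
    Tendsto μ atTop (𝓝 ν) := by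
  have hopen : ∀ (s : Finset ℕ+) (m : ℕ+ → ℕ), IsOpen {x : ℕ+ → ℕ | ∀ k ∈ s, x k = m k} :=
    fun s m ↦ by
      simpa [Set.pi] using isOpen_set_pi (s := fun k ↦ {m k}) s.finite_toSet
        fun k _ ↦ isOpen_discrete _
  -- As `ℕ` is discrete, cylinders are open and form a neighbourhood basis at each point.
  refine isPiSystem_cylinders.tendsto_probabilityMeasure_of_tendsto_of_mem ?_ ?_ ?_
  · rintro _ ⟨s, m, rfl⟩
    exact (hopen s m).measurableSet
  · intro u hu x hx
    obtain ⟨s, v, hv, hsub⟩ := isOpen_pi_iff.1 hu x hx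
    refine ⟨_, ⟨s, x, rfl⟩, (hopen s x).mem_nhds fun _ _ ↦ rfl, fun y hy ↦ hsub fun k hk ↦ ?_⟩
    rw [hy k hk]
    exact (hv k hk).2
  · rintro _ ⟨s, m, rfl⟩
    rw [← NNReal.tendsto_coe]
    exact h s m

end Probability

end MagicalSquare

/-! ### The theorem: comparison of cylinder probabilities with those of the limit. -/

theorem mainTheorem1
    (r : ℕ) (hr : 2 ≤ r)
    -- `A n` is uniformly distributed on the magical squares of dimension `n` and line sum `r`
    {Ω : ℕ → Type*} [∀ n, MeasurableSpace (Ω n)]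
    (P : ∀ n, Measure (Ω n)) [∀ n, IsProbabilityMeasure (P n)]
    (A : ∀ n, Ω n → Matrix (Fin n) (Fin n) ℕ)
    (hA : ∀ n, HasLaw (A n) (uniformOn (MagicalSquare.magicalSquares n r)) (P n))
    -- the limiting sequence `Z`
    {Ω' : Type*} [MeasurableSpace Ω'] (Q : Measure Ω') [IsProbabilityMeasure Q]
    (Z : ℕ+ → Ω' → ℕ)
    (hZ_two : r = 2 → iIndepFun Z Q ∧ HasLaw (Z 1) (poissonMeasure 1) Q ∧
      ∀ i : ℕ+, 2 ≤ i → HasLaw (Z i) (poissonMeasure (1 / (2 * ((i : ℕ) : ℝ≥0)))) Q)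
    (hZ_three : 3 ≤ r → ∀ i ω, Z i ω = 0) :
    TendstoInDistribution
      (fun n ω (k : ℕ+) ↦ MagicalSquare.componentCount r (A n ω) (k : ℕ)) atTop
      (fun ω k ↦ Z k ω) P Q := by
  have hr0 : 0 < r := by omega
  have hY : ∀ n, Measurable fun (M : Matrix (Fin n) (Fin n) ℕ) (k : ℕ+) ↦
      MagicalSquare.componentCount r M (k : ℕ) := fun n ↦ Measurable.of_discrete
  have hZ : ∀ k, AEMeasurable (Z k) Q := fun k ↦ by
    rcases hr.eq_or_lt with h | h
    · obtain ⟨-, h1, h2⟩ := hZ_two h.symm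
      rcases (one_le (a := k)).eq_or_lt with rfl | hk
      · exact h1.aemeasurable
      · exact (h2 k (PNat.add_one_le_iff.2 hk)).aemeasurable
    · simp [funext (hZ_three h k)]
  have hX : ∀ n, AEMeasurable (fun ω (k : ℕ+) ↦ MagicalSquare.componentCount r (A n ω) (k : ℕ))
      (P n) := fun n ↦ (hY n).comp_aemeasurable (hA n).aemeasurable
  have hmeas : ∀ (s : Finset ℕ+) (m : ℕ+ → ℕ),
      MeasurableSet {x : ℕ+ → ℕ | ∀ k ∈ s, x k = m k} := fun s m ↦ by
    simpa [Set.pi] using MeasurableSet.pi (s := (s : Set ℕ+)) (t := fun k ↦ {m k})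
      s.countable_toSet fun k _ ↦ MeasurableSet.of_discrete
  refine ⟨hX, aemeasurable_pi_lambda _ hZ, MagicalSquare.tendsto_of_tendsto_cylinders
    fun s m ↦ ?_⟩
  have hleft : ∀ n, ((P n).map fun ω (k : ℕ+) ↦
      MagicalSquare.componentCount r (A n ω) (k : ℕ)).real {x | ∀ k ∈ s, x k = m k} =
      MagicalSquare.normSum r n (fun x ↦ ∏ k ∈ s, if x k = m k then 1 else 0) /
        MagicalSquare.normCard r n := fun n ↦ by
    rw [← MagicalSquare.uniformOn_real_cylinder hr0, ← (hA n).map_eq, measureReal_def,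
      measureReal_def, Measure.map_apply_of_aemeasurable (hX n) (hmeas s m),
      Measure.map_apply_of_aemeasurable (hA n).aemeasurable (hY n (hmeas s m))]
    rfl
  have hright : (Q.map fun ω k ↦ Z k ω).real {x | ∀ k ∈ s, x k = m k} =
      Q.real {ω | ∀ k ∈ s, Z k ω = m k} := by
    rw [measureReal_def, Measure.map_apply_of_aemeasurable (aemeasurable_pi_lambda _ hZ)
      (hmeas s m)]
    rfl
  simp only [ProbabilityMeasure.coe_mk, hleft, hright]
  rcases hr.eq_or_lt with h | h
  · subst h
    obtain ⟨hind, h1, h2⟩ := hZ_two rfl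
    -- The Poisson parameters are the rates `irrRate 2 k`; the value 1 at `k = 1` does not follow
    -- the pattern `1 / (2 * k)`, since there `σ = τ` and the two ordered pairs coincide.
    have hlaw : ∀ k : ℕ+, ∀ t, Q.real (Z k ⁻¹' {t}) =
        Real.exp (-MagicalSquare.irrRate 2 k) * MagicalSquare.irrRate 2 k ^ t / t.factorial :=
      fun k t ↦ by
        rw [measureReal_def, ← Measure.map_apply_of_aemeasurable (hZ k) (measurableSet_singleton t)]
        rcases (one_le (a := k)).eq_or_lt with rfl | hk
        · rw [h1.map_eq, ← measureReal_def, poissonMeasure_real_singleton, PNat.one_coe,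
            MagicalSquare.irrRate_one two_pos]
          simp
        · have hk2 : 2 ≤ (k : ℕ) := hk
          rw [(h2 k (PNat.add_one_le_iff.2 hk)).map_eq, ← measureReal_def,
            poissonMeasure_real_singleton, MagicalSquare.irrRate_two hk2]
          simp
    have hprod : Q.real {ω | ∀ k ∈ s, Z k ω = m k} = ∏ k ∈ s, Q.real (Z k ⁻¹' {m k}) := by
      have := hind.measure_inter_preimage_eq_mul s (sets := fun k ↦ {m k})
        fun k _ ↦ MeasurableSet.of_discrete
      have hset : {ω | ∀ k ∈ s, Z k ω = m k} = ⋂ k ∈ s, Z k ⁻¹' {m k} := by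
        ext ω
        simp
      rw [hset, measureReal_def, this, ENNReal.toReal_prod]
      rfl
    rw [hprod, Finset.prod_congr rfl fun k _ ↦ hlaw k (m k)]
    exact MagicalSquare.tendsto_normSum_prod (q := fun k t ↦ Real.exp (-MagicalSquare.irrRate 2 k) *
        MagicalSquare.irrRate 2 k ^ t / t.factorial) (fun k F L hF1 hF hL t ↦
      MagicalSquare.tendsto_normSum_ite_eq two_pos MagicalSquare.normCard_two_le
        MagicalSquare.tendsto_normCard_two k.pos hF1 hF hL t) s m
  · have hQ : Q.real {ω | ∀ k ∈ s, Z k ω = m k} = ∏ k ∈ s, if m k = 0 then 1 else 0 := by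
      rw [Finset.prod_boole]
      split_ifs with hm
      · rw [Set.eq_univ_of_forall (s := {ω | ∀ k ∈ s, Z k ω = m k})
          fun ω k hk ↦ (hZ_three h k ω).trans (hm k hk).symm, probReal_univ]
      · rw [Set.eq_empty_of_forall_notMem (s := {ω | ∀ k ∈ s, Z k ω = m k})
          fun ω hω ↦ hm fun k hk ↦ (hω k hk).symm.trans (hZ_three h k ω), measureReal_empty]
    rw [hQ]
    exact MagicalSquare.tendsto_normSum_prod (q := fun _ t ↦ if t = 0 then 1 else 0)
      (fun k F L hF1 _ hL t ↦ MagicalSquare.tendsto_normSum_ite_eq_of_tendsto_zero hr0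
        (MagicalSquare.tendsto_normCard_div_zero h) k.pos hF1 hL t) s m
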